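/- Let $d\in\mathbb N$, let $p,q\in[1,\infty]$ satisfy $1/p+1/q=1$, and let $\beta_*\in\mathbb R^d$. Let $(X,Y)$ be a random element of $\mathbb R^d\times\{-1,1\}$ following the logistic regression model $$\log\frac{P(Y=1\mid X=x)}{1-P(Y=1\mid X=x)}=\beta_*^Tx\qquad\text{(for almost every }x),$$ where $X$ has a density with respect to Lebesgue measure on $\mathbb R^d$ that is positive almost everywhere, and suppose that $E\|X\|_2^2<\infty$. Let $(X_1,Y_1),(X_2,Y_2),\dots$ be i.i.d. copies of $(X,Y)$ and let $P_n$ be the empirical measure of the first $n$ of them. Put $$N_q\big((x,y),(u,v)\big)=\begin{cases}\|x-u\|_q,& y=v,\\ \infty,&\text{otherwise,}\end{cases}$$ and, for probability measures $P,Q$ on $\mathbb R^d\times\mathbb R$, let $\mathcal D(P,Q)$ be the infimum of $E_\pi[N_q(U,W)]$ over all joint laws $\pi$ of $(U,W)$ with marginals $U\sim P$ and $W\sim Q$. Let $$h(x,y;\beta)=\frac{-yx}{1+\exp(y\beta^Tx)},$$ which is the gradient in $\beta$ of the loss $\log(1+\exp(-y\beta^Tx))$, and let $$R_n(\beta)=\inf\big\{\mathcal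 D(P,P_n): P\text{ a probability measure on }\mathbb R^d\times\mathbb R,\ E_P[h(X,Y;\beta)]=\mathbf 0\big\},$$ where $h(\cdot;\beta)$ is required to be $P$-integrable. Let $$A=\Big\{\xi\in\mathbb R^d:\ \operatorname{ess\,sup}\,\big\|\xi^TD_xh(X,Y;\beta_*)\big\|_p\le 1\Big\},$$ where $D_xh$ is the Jacobian matrix of $h$ in $x$ and the essential supremum is with respect to the law of $(X,Y)$. Let $$Z\sim\mathcal N\Big(\mathbf 0,\ E\Big[\frac{XX^T}{(1+\exp(Y\beta_*^TX))^2}\Big]\Big),\qquad \tilde Z\sim\mathcal N\big(\mathbf 0,E[XX^T]\big).$$ Then $R_n(\beta_*)<\infty$ for all $n\ge1$, $\sup_{\xi\in A}\xi^Tz<\infty$ for every $z\in\mathbb R^d$, and, as $n\to\infty$, $$\sqrt n\,R_n(\beta_*)\Rightarrow L_3:=\sup_{\xi\in A}\xi^TZ$$ in distribution. Moreover $L_3$ is stochastically dominated by $L_4:=\|\tilde Z\|_q$, that is, $P(L_3>t)\le P(L_4>t)$ for every $t\in\mathbb R$. -/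

import Mathlib

open MeasureTheory ProbabilityTheory Filter Topology
open scoped ENNReal

namespace LogisticRWP

noncomputable section

/-- The `ℓ_r` norm of a vector of `ℝ^d`, for `r ∈ [1, ∞]`. -/
def lrNorm {d : ℕ} (r : ℝ≥0∞) (v : Fin d → ℝ) : ℝ := ‖WithLp.toLp r v‖

/-- The cost `N_q((x,y),(u,v))`: it is `‖x - u‖_q` if `y = v`, and `∞` otherwise. -/
def costN {d : ℕ} (q : ℝ≥0∞) (w w' : EuclideanSpace ℝ (Fin d) × ℝ) : ℝ≥0∞ :=
  open Classical in
  if w.2 = w'.2 then ENNReal.ofReal (lrNorm q (w.1 - w'.1).ofLp) else ∞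

/-- The optimal transport cost `D_c(P, Q)`: the infimum of `E_π[c(U, W)]` over the couplings `π`
of `P` and `Q`. -/
def transportCost {S : Type*} [MeasurableSpace S] (c : S → S → ℝ≥0∞) (P Q : Measure S) : ℝ≥0∞ :=
  ⨅ (π : Measure (S × S)) (_ : π.fst = P) (_ : π.snd = Q), ∫⁻ z, c z.1 z.2 ∂π

/-- The empirical measure of the first `n` terms of a sequence of data points. -/
def empirical {S : Type*} [MeasurableSpace S] (n : ℕ) (w : ℕ → S) : Measure S :=
  (n : ℝ≥0∞)⁻¹ • ∑ i ∈ Finset.range n, Measure.dirac (w i)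

/-- `h(x, y; β) = -y x / (1 + exp(y βᵀx))`, the gradient in `β` of `log(1 + exp(-y βᵀx))`. -/
def score {d : ℕ} (β x : EuclideanSpace ℝ (Fin d)) (y : ℝ) : EuclideanSpace ℝ (Fin d) :=
  (-y / (1 + Real.exp (y * inner ℝ β x))) • x

/-- The Jacobian matrix `D_x h(x, y; β)`, with entries `∂h_i/∂x_j`. -/
def scoreJacobian {d : ℕ} (β x : EuclideanSpace ℝ (Fin d)) (y : ℝ) : Matrix (Fin d) (Fin d) ℝ :=
  Matrix.of fun i j ↦ fderiv ℝ (fun x' ↦ score β x' y) x (EuclideanSpace.single j 1) i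

/-- The robust Wasserstein profile function `inf {D_c(P, Q) : E_P[h(X, Y; β)] = 0}` at a reference
measure `Q`, for the cost `c = N_q`; here `P` runs over probability measures for which
`h(·; β)` is integrable. -/
def profile {d : ℕ} (q : ℝ≥0∞) (β : EuclideanSpace ℝ (Fin d))
    (Q : Measure (EuclideanSpace ℝ (Fin d) × ℝ)) : ℝ≥0∞ :=
  ⨅ (P : Measure (EuclideanSpace ℝ (Fin d) × ℝ)) (_ : IsProbabilityMeasure P)
    (_ : Integrable (fun w ↦ score β w.1 w.2) P) (_ : ∫ w, score β w.1 w.2 ∂P = 0),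
    transportCost (costN q) P Q

/-- The null hypothesis on the law `μ` of `(X, Y)`: `Y ∈ {-1, 1}`, the log-odds of `Y = 1` given
`X = x` equal `βᵀx`, and `X` has an almost everywhere positive Lebesgue density. -/
structure IsLogisticModel {d : ℕ} (β : EuclideanSpace ℝ (Fin d))
    (μ : Measure (EuclideanSpace ℝ (Fin d) × ℝ)) [IsProbabilityMeasure μ] : Prop where
  label : ∀ᵐ w ∂μ, w.2 = -1 ∨ w.2 = 1
  logOdds : ∀ᵐ x ∂μ.fst,
    0 < (μ.condKernel x).real {1} ∧ (μ.condKernel x).real {1} < 1 ∧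
      Real.log ((μ.condKernel x).real {1} / (1 - (μ.condKernel x).real {1})) = inner ℝ β x
  density : ∃ f : EuclideanSpace ℝ (Fin d) → ℝ≥0∞,
    Measurable f ∧ μ.fst = volume.withDensity f ∧ ∀ᵐ x, 0 < f x

/-- The matrix `E[XXᵀ / (1 + exp(Y βᵀX))²]`. -/
def scoreCov {d : ℕ} (β : EuclideanSpace ℝ (Fin d))
    (μ : Measure (EuclideanSpace ℝ (Fin d) × ℝ)) : Matrix (Fin d) (Fin d) ℝ :=
  Matrix.of fun i j ↦ ∫ w, w.1 i * w.1 j / (1 + Real.exp (w.2 * inner ℝ β w.1)) ^ 2 ∂μ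

/-- The matrix `E[XXᵀ]`. -/
def secondMoment {d : ℕ}
    (μ : Measure (EuclideanSpace ℝ (Fin d) × ℝ)) : Matrix (Fin d) (Fin d) ℝ :=
  Matrix.of fun i j ↦ ∫ w, w.1 i * w.1 j ∂μ

/-- The set `A` of all `ξ` with `ess sup ‖ξᵀ D_x h(X, Y; β)‖_p ≤ 1`. -/
def dualSet {d : ℕ} (p : ℝ≥0∞) (β : EuclideanSpace ℝ (Fin d))
    (μ : Measure (EuclideanSpace ℝ (Fin d) × ℝ)) : Set (EuclideanSpace ℝ (Fin d)) :=
  {ξ | essSup (fun w ↦ ENNReal.ofReal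
    (lrNorm p (Matrix.vecMul ξ.ofLp (scoreJacobian β w.1 w.2)))) μ ≤ 1}

/-- `sup_{ξ ∈ A} ξᵀz`. -/
def limitFun {d : ℕ} (p : ℝ≥0∞) (β : EuclideanSpace ℝ (Fin d))
    (μ : Measure (EuclideanSpace ℝ (Fin d) × ℝ)) (z : EuclideanSpace ℝ (Fin d)) : ℝ :=
  sSup ((fun ξ ↦ inner ℝ ξ z) '' dualSet p β μ)

end

end LogisticRWP

/-! Write `L` for `limitFun`, `M` for the empirical mean of `score` and `H = -√n M` for
`normalizedScore`. The theorem follows from a sandwich between `L(H)` and `√n R_n`, a central limit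
theorem for `H` and continuity of `L`.

Lower bound (weak duality). The law of `(X, Y)` charges every nonempty open set of `x` for both
labels, so `ξ` lies in `dualSet` iff `x ↦ ⟪ξ, h(x, y)⟫` is 1-Lipschitz for `ℓ_q` when `y = ±1`.
Integrating this bound over a coupling of `P` and `P_n` with `E_P h = 0` gives `-⟪ξ, M⟫ ≤` cost,
that is, `L(H) ≤ √n R_n`.

Upper bound. If `ζ` is at distance at least `r` from `dualSet`, some move `x ↦ x + e` violates the
Lipschitz bound, and still does so for nearby `ζ` and `x`; by compactness finitely many moves
suffice (`exists_moves`). The required budget is of order `1/√n`, while each region of starting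
points holds a positive fraction of the sample, so every move is affordable. The values of `E_P h`
attainable at cost `C` form a convex set. If `0` were not attainable at cost `C = (L(H) + δ)/√n`, a
separating functional, rescaled, would be a `ζ` with `⟪ζ, H⟫ = L(H) + δ`; it is far from `dualSet`,
and a profitable move contradicts the separation (`profile_empirical_le_of_moves`).

Domination. For `β = 0` the gradient at the origin gives `‖ξ‖_p ≤ 2`, so `L(Z) ≤ ‖2Z‖_q`, and `2Z`
has the law of `Z'`. For `β ≠ 0` the gradient grows linearly on the hyperplane orthogonal to `β`
unless `ξ` is parallel to `β`; hence `L(Z) ≤ |⟪β, Z⟫| / ‖β‖_p`. The variance of `⟪β, Z⟫` is at most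
that of `⟪β, Z'⟫`, and Hölder finishes. -/

namespace LogisticRWP

/-! ### Norms `ℓ_r` on `ℝ^d` and their duality. -/

section LrNorm

variable {d : ℕ} {p q : ℝ≥0∞}

lemma lrNorm_nonneg (r : ℝ≥0∞) [Fact (1 ≤ r)] (v : Fin d → ℝ) : 0 ≤ lrNorm r v :=
  norm_nonneg _

lemma lrNorm_zero (r : ℝ≥0∞) [Fact (1 ≤ r)] : lrNorm r (0 : Fin d → ℝ) = 0 := by
  simp [lrNorm]

lemma lrNorm_neg (r : ℝ≥0∞) [Fact (1 ≤ r)] (v : Fin d → ℝ) : lrNorm r (-v) = lrNorm r v := by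
  simp [lrNorm]

lemma lrNorm_smul (r : ℝ≥0∞) [Fact (1 ≤ r)] (a : ℝ) (v : Fin d → ℝ) :
    lrNorm r (a • v) = |a| * lrNorm r v := by
  simp [lrNorm, norm_smul]

lemma lrNorm_add_le (r : ℝ≥0∞) [Fact (1 ≤ r)] (u v : Fin d → ℝ) :
    lrNorm r (u + v) ≤ lrNorm r u + lrNorm r v := by
  simpa [lrNorm] using norm_add_le (WithLp.toLp r u) (WithLp.toLp r v)

lemma lrNorm_eq_zero {r : ℝ≥0∞} [Fact (1 ≤ r)] {v : Fin d → ℝ} (h : lrNorm r v = 0) : v = 0 := by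
  simpa [lrNorm] using h

lemma lrNorm_pos {r : ℝ≥0∞} [Fact (1 ≤ r)] {v : Fin d → ℝ} (h : v ≠ 0) : 0 < lrNorm r v :=
  (lrNorm_nonneg r v).lt_of_ne fun h0 ↦ h (lrNorm_eq_zero h0.symm)

lemma continuous_lrNorm (r : ℝ≥0∞) [Fact (1 ≤ r)] :
    Continuous (lrNorm r : (Fin d → ℝ) → ℝ) :=
  (PiLp.continuous_toLp r _).norm

lemma abs_apply_le_lrNorm (r : ℝ≥0∞) [Fact (1 ≤ r)] (v : Fin d → ℝ) (i : Fin d) :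
    |v i| ≤ lrNorm r v :=
  PiLp.norm_apply_le (WithLp.toLp r v) i

lemma exists_norm_le_mul_lrNorm (r : ℝ≥0∞) [Fact (1 ≤ r)] (d : ℕ) :
    ∃ C : ℝ, 0 ≤ C ∧ ∀ v : EuclideanSpace ℝ (Fin d), ‖v‖ ≤ C * lrNorm r v.ofLp := by
  refine ⟨√d, by positivity, fun v ↦ ?_⟩
  have h0 := lrNorm_nonneg r v.ofLp
  rw [EuclideanSpace.norm_eq]
  refine Real.sqrt_le_iff.2 ⟨by positivity, ?_⟩
  calc ∑ i, ‖v i‖ ^ 2 ≤ ∑ _i : Fin d, lrNorm r v.ofLp ^ 2 := by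
        gcongr with i
        exact abs_apply_le_lrNorm r v.ofLp i
    _ = (√d * lrNorm r v.ofLp) ^ 2 := by
        rw [mul_pow, Real.sq_sqrt (by positivity)]; simp

lemma lrNorm_top_le {v : Fin d → ℝ} {C : ℝ} (hC : 0 ≤ C) (h : ∀ i, |v i| ≤ C) :
    lrNorm ∞ v ≤ C := by
  rw [lrNorm, PiLp.norm_eq_ciSup]
  exact Real.iSup_le h hC

lemma lrNorm_one_eq (v : Fin d → ℝ) : lrNorm 1 v = ∑ i, |v i| := by
  rw [lrNorm, PiLp.norm_eq_of_L1]; rfl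

lemma lrNorm_eq_sum {r : ℝ≥0∞} (hr : 0 < r.toReal) (v : Fin d → ℝ) :
    lrNorm r v = (∑ i, |v i| ^ r.toReal) ^ (1 / r.toReal) := by
  rw [lrNorm, PiLp.norm_eq_sum hr]; rfl

lemma sum_mul_le_lrNorm_top_mul_one (u v : Fin d → ℝ) :
    ∑ i, u i * v i ≤ lrNorm ∞ u * lrNorm 1 v := by
  rw [lrNorm_one_eq, Finset.mul_sum]
  refine Finset.sum_le_sum fun i _ ↦ ?_
  calc u i * v i ≤ |u i| * |v i| := by rw [← abs_mul]; exact le_abs_self _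
    _ ≤ _ := by gcongr; exact abs_apply_le_lrNorm ∞ u i

/-- Isolates the endpoint exponents, which the real-exponent Hölder inequality excludes. -/
lemma holderConjugate_cases (hpq : p.HolderConjugate q) :
    (p = 1 ∧ q = ∞) ∨ (p = ∞ ∧ q = 1) ∨ p.toReal.HolderConjugate q.toReal := by
  have := hpq
  rcases eq_or_ne p ∞ with rfl | hp
  · right; left
    exact ⟨rfl, (ENNReal.HolderConjugate.eq_top_iff_eq_one ∞ q).1 rfl⟩
  rcases eq_or_ne q ∞ with rfl | hq
  · left
    exact ⟨by have := hpq.symm; exact (ENNReal.HolderConjugate.eq_top_iff_eq_one ∞ p).1 rfl, rfl⟩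
  right; right
  have h1 : p⁻¹ + q⁻¹ = 1 := ENNReal.holderConjugate_iff.1 hpq
  have hp0 : p ≠ 0 := ENNReal.HolderConjugate.ne_zero p q
  have hq0 : q ≠ 0 := by have := hpq.symm; exact ENNReal.HolderConjugate.ne_zero q p
  refine ⟨?_, ENNReal.toReal_pos hp0 hp, ENNReal.toReal_pos hq0 hq⟩
  have := congrArg ENNReal.toReal h1
  rwa [ENNReal.toReal_add (by simpa) (by simpa), ENNReal.toReal_inv, ENNReal.toReal_inv,
    ENNReal.toReal_one, ← inv_one] at this

/-- Hölder's inequality. -/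
lemma sum_mul_le_lrNorm_mul (hpq : p.HolderConjugate q) (u v : Fin d → ℝ) :
    ∑ i, u i * v i ≤ lrNorm p u * lrNorm q v := by
  rcases holderConjugate_cases hpq with ⟨rfl, rfl⟩ | ⟨rfl, rfl⟩ | h
  · rw [mul_comm]
    simpa [mul_comm] using sum_mul_le_lrNorm_top_mul_one v u
  · exact sum_mul_le_lrNorm_top_mul_one u v
  · rw [lrNorm_eq_sum h.pos, lrNorm_eq_sum h.symm.pos]
    exact Real.inner_le_Lp_mul_Lq _ _ _ h

/-- The `ℓ_p` norm is the dual norm of the `ℓ_q` norm. -/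
lemma lrNorm_le_of_forall_sum_le (hpq : p.HolderConjugate q) {g : Fin d → ℝ} {C : ℝ} (hC : 0 ≤ C)
    (h : ∀ e : Fin d → ℝ, ∑ i, g i * e i ≤ C * lrNorm q e) : lrNorm p g ≤ C := by
  rcases holderConjugate_cases hpq with ⟨rfl, rfl⟩ | ⟨rfl, rfl⟩ | hr
  · rw [lrNorm_one_eq]
    calc ∑ i, |g i| = ∑ i, g i * SignType.sign (g i) := by simp
      _ ≤ C * lrNorm ∞ (fun i ↦ ((SignType.sign (g i) : SignType) : ℝ)) := h _
      _ ≤ C * 1 := by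
        gcongr
        refine lrNorm_top_le zero_le_one fun i ↦ ?_
        rcases lt_trichotomy (g i) 0 with h | h | h <;> simp [h]
      _ = C := mul_one C
  · refine lrNorm_top_le hC fun i ↦ ?_
    have := h (Pi.single i (SignType.sign (g i) : ℝ))
    rw [lrNorm_one_eq, Finset.sum_eq_single i (by intro j _ hj; simp [hj]) (by simp),
      Finset.sum_eq_single i (by intro j _ hj; simp [hj]) (by simp)] at this
    simp only [Pi.single_eq_same, self_mul_sign] at this
    refine this.trans (mul_le_of_le_one_right hC ?_)
    rcases lt_trichotomy (g i) 0 with h | h | h <;> simp [h]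
  -- The extremal `w` for `|g|`, given the signs of `g`, is the test vector.
  · obtain ⟨⟨w, hw, hwg⟩, -⟩ := NNReal.isGreatest_Lp Finset.univ (fun i ↦ ‖g i‖₊) hr
    simp only [Set.mem_ofPred_eq] at hw
    have hg : lrNorm p g = ∑ i, |g i| * w i := by
      rw [lrNorm_eq_sum hr.pos]
      have := congrArg NNReal.toReal hwg
      push_cast at this
      simpa using this.symm
    have h1 : lrNorm q (fun i ↦ SignType.sign (g i) * (w i : ℝ)) ≤ 1 := by
      rw [lrNorm_eq_sum hr.symm.pos]
      refine Real.rpow_le_one (Finset.sum_nonneg fun i _ ↦ by positivity) ?_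
        (by have := hr.symm.pos; positivity)
      refine le_trans ?_ (NNReal.coe_le_coe.2 hw)
      push_cast
      gcongr with i
      rw [abs_mul, NNReal.abs_eq]
      refine mul_le_of_le_one_left (by positivity) ?_
      rcases lt_trichotomy (g i) 0 with h | h | h <;> simp [h]
    calc lrNorm p g = ∑ i, g i * (SignType.sign (g i) * (w i : ℝ)) := by
          rw [hg]; simp [← mul_assoc]
      _ ≤ C * lrNorm q (fun i ↦ SignType.sign (g i) * (w i : ℝ)) := h _
      _ ≤ C * 1 := by gcongr
      _ = C := mul_one C

lemma inner_le_lrNorm_mul (hpq : p.HolderConjugate q) (u v : EuclideanSpace ℝ (Fin d)) :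
    inner ℝ u v ≤ lrNorm p u.ofLp * lrNorm q v.ofLp := by
  refine le_trans (le_of_eq ?_) (sum_mul_le_lrNorm_mul hpq _ _)
  simp [PiLp.inner_apply, mul_comm]

lemma lrNorm_le_of_forall_inner_le (hpq : p.HolderConjugate q) {g : EuclideanSpace ℝ (Fin d)}
    {C : ℝ} (hC : 0 ≤ C) (h : ∀ e : EuclideanSpace ℝ (Fin d), inner ℝ g e ≤ C * lrNorm q e.ofLp) :
    lrNorm p g.ofLp ≤ C := by
  refine lrNorm_le_of_forall_sum_le hpq hC fun e ↦ ?_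
  refine le_trans (le_of_eq ?_) (h (WithLp.toLp 2 e))
  simp [PiLp.inner_apply, mul_comm]

lemma fact_one_le_left (hpq : p.HolderConjugate q) : Fact (1 ≤ p) :=
  ⟨have := hpq; ENNReal.HolderConjugate.one_le p q⟩

lemma fact_one_le_right (hpq : p.HolderConjugate q) : Fact (1 ≤ q) :=
  fact_one_le_left hpq.symm

end LrNorm

/-! ### The gradient of the score and Lipschitz bounds. -/

section Score

variable {d : ℕ} {p q : ℝ≥0∞}

/-- The gradient in `x` of `⟪ξ, h(x, y; β)⟫`. -/
noncomputable def scoreGrad (β ξ x : EuclideanSpace ℝ (Fin d)) (y : ℝ) : EuclideanSpace ℝ (Fin d) :=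
  (-y / (1 + Real.exp (y * inner ℝ β x))) • ξ +
    (y ^ 2 * Real.exp (y * inner ℝ β x) / (1 + Real.exp (y * inner ℝ β x)) ^ 2 * inner ℝ ξ x) • β

lemma one_add_exp_ne_zero (t : ℝ) : 1 + Real.exp t ≠ 0 := by positivity

lemma continuous_score (β : EuclideanSpace ℝ (Fin d)) :
    Continuous fun w : EuclideanSpace ℝ (Fin d) × ℝ ↦ score β w.1 w.2 := by
  unfold score
  have h : Continuous fun w : EuclideanSpace ℝ (Fin d) × ℝ ↦ 1 + Real.exp (w.2 * inner ℝ β w.1) := by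
    fun_prop
  exact (continuous_snd.neg.div h fun _ ↦ one_add_exp_ne_zero _).smul continuous_fst

lemma continuous_scoreGrad (β ξ : EuclideanSpace ℝ (Fin d)) :
    Continuous fun w : EuclideanSpace ℝ (Fin d) × ℝ ↦ scoreGrad β ξ w.1 w.2 := by
  unfold scoreGrad
  have h : Continuous fun w : EuclideanSpace ℝ (Fin d) × ℝ ↦ Real.exp (w.2 * inner ℝ β w.1) := by
    fun_prop
  have h1 := continuous_snd.neg.div (h.const_add 1) fun _ ↦ one_add_exp_ne_zero _
  have h2 := ((continuous_snd.pow 2).mul h).div ((h.const_add 1).pow 2)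
    fun _ ↦ pow_ne_zero _ (one_add_exp_ne_zero _)
  exact (h1.smul continuous_const).add
    ((h2.mul (continuous_const.inner continuous_fst)).smul continuous_const)

lemma score_zero (β : EuclideanSpace ℝ (Fin d)) (y : ℝ) : score β 0 y = 0 := by simp [score]

lemma norm_score_le (β x : EuclideanSpace ℝ (Fin d)) (y : ℝ) : ‖score β x y‖ ≤ |y| * ‖x‖ := by
  rw [score, norm_smul]
  gcongr
  rw [Real.norm_eq_abs, abs_div, abs_neg, abs_of_pos (by positivity : 0 < 1 + Real.exp _)]
  exact div_le_self (abs_nonneg _) (by linarith [Real.exp_pos (y * inner ℝ β x)])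

lemma hasFDerivAt_score (β x : EuclideanSpace ℝ (Fin d)) (y : ℝ) :
    HasFDerivAt (fun x' ↦ score β x' y)
      ((-y / (1 + Real.exp (y * inner ℝ β x))) • ContinuousLinearMap.id ℝ _ +
        (((y ^ 2 * Real.exp (y * inner ℝ β x) / (1 + Real.exp (y * inner ℝ β x)) ^ 2)) •
          innerSL ℝ β).smulRight x) x := by
  have h1 : HasFDerivAt (fun x' : EuclideanSpace ℝ (Fin d) ↦ inner ℝ β x') (innerSL ℝ β) x :=
    (innerSL ℝ β).hasFDerivAt
  have h2 : HasDerivAt (fun s : ℝ ↦ -y / (1 + Real.exp (y * s)))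
      (y ^ 2 * Real.exp (y * inner ℝ β x) / (1 + Real.exp (y * inner ℝ β x)) ^ 2)
      (inner ℝ β x) := by
    have h3 : HasDerivAt (fun s : ℝ ↦ 1 + Real.exp (y * s))
        (Real.exp (y * inner ℝ β x) * y) (inner ℝ β x) := by
      have := (((hasDerivAt_id (inner ℝ β x)).const_mul y).exp).const_add 1
      simpa using this
    convert! (hasDerivAt_const (inner ℝ β x) (-y)).div h3 (one_add_exp_ne_zero _) using 1
    ring
  have h4 := (h2.comp_hasFDerivAt x h1).smul (hasFDerivAt_id x)
  exact h4

lemma hasFDerivAt_inner_score (β ξ x : EuclideanSpace ℝ (Fin d)) (y : ℝ) :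
    HasFDerivAt (fun x' ↦ inner ℝ ξ (score β x' y)) (innerSL ℝ (scoreGrad β ξ x y)) x := by
  convert! (innerSL ℝ ξ).hasFDerivAt.comp x (hasFDerivAt_score β x y) using 1
  ext e
  simp [scoreGrad]
  ring

lemma vecMul_scoreJacobian (β ξ x : EuclideanSpace ℝ (Fin d)) (y : ℝ) :
    Matrix.vecMul ξ.ofLp (scoreJacobian β x y) = (scoreGrad β ξ x y).ofLp := by
  ext j
  have h1 : ∑ i, ξ i * fderiv ℝ (fun x' ↦ score β x' y) x (EuclideanSpace.single j 1) i =
      inner ℝ ξ (fderiv ℝ (fun x' ↦ score β x' y) x (EuclideanSpace.single j 1)) := by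
    simp [PiLp.inner_apply, mul_comm]
  have h2 := (hasFDerivAt_inner_score β ξ x y).unique
    ((innerSL ℝ ξ).hasFDerivAt.comp x (hasFDerivAt_score β x y))
  have h3 := congrArg (fun L ↦ L (EuclideanSpace.single j (1 : ℝ))) h2
  simp only [ContinuousLinearMap.comp_apply, innerSL_apply_apply] at h3
  rw [Matrix.vecMul, dotProduct]
  simp only [scoreJacobian, Matrix.of_apply]
  rw [h1, (hasFDerivAt_score β x y).fderiv, ← h3]
  simp [EuclideanSpace.inner_single_right]

/-- A bound on the dual norm of the gradient is the same as a Lipschitz bound. -/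
lemma lrNorm_scoreGrad_le_one_iff (hpq : p.HolderConjugate q) (β ξ : EuclideanSpace ℝ (Fin d))
    (y : ℝ) :
    (∀ x, lrNorm p (scoreGrad β ξ x y).ofLp ≤ 1) ↔
      ∀ x e, inner ℝ ξ (score β (x + e) y - score β x y) ≤ lrNorm q e.ofLp := by
  have : Fact (1 ≤ p) := fact_one_le_left hpq
  have : Fact (1 ≤ q) := fact_one_le_right hpq
  have hline (x e : EuclideanSpace ℝ (Fin d)) (t : ℝ) :
      HasDerivAt (fun t : ℝ ↦ inner ℝ ξ (score β (x + t • e) y))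
        (inner ℝ (scoreGrad β ξ (x + t • e) y) e) t := by
    have h1 : HasDerivAt (fun t : ℝ ↦ x + t • e) e t := by
      simpa using ((hasDerivAt_id t).smul_const e).const_add x
    exact (hasFDerivAt_inner_score β ξ (x + t • e) y).comp_hasDerivAt t h1
  constructor
  · intro h x e
    -- Mean value inequality along the segment from `x` to `x + e`.
    have h1 := image_le_of_deriv_right_le_deriv_boundary
      (f := fun t : ℝ ↦ inner ℝ ξ (score β (x + t • e) y)) (a := 0) (b := 1)
      (f' := fun t ↦ inner ℝ (scoreGrad β ξ (x + t • e) y) e)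
      (B := fun t ↦ inner ℝ ξ (score β x y) + t * lrNorm q e.ofLp)
      (B' := fun _ ↦ lrNorm q e.ofLp)
      (fun t _ ↦ (hline x e t).continuousAt.continuousWithinAt)
      (fun t _ ↦ (hline x e t).hasDerivWithinAt) (by simp) (by fun_prop)
      (fun t _ ↦ by
        simpa using (((hasDerivAt_id t).mul_const (lrNorm q e.ofLp)).const_add
          (inner ℝ ξ (score β x y))).hasDerivWithinAt)
      (fun t _ ↦ (inner_le_lrNorm_mul hpq _ _).trans
        (mul_le_of_le_one_left (lrNorm_nonneg _ _) (h _)))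
      (x := 1) (by simp)
    simp only [one_smul, one_mul] at h1
    rw [inner_sub_right]
    linarith
  · intro h x
    refine lrNorm_le_of_forall_inner_le hpq zero_le_one fun e ↦ ?_
    -- Only right difference quotients at `0` are bounded by the hypothesis, which suffices.
    have h1 := (hline x e 0).hasDerivWithinAt (s := Set.Ioi 0)
    rw [hasDerivWithinAt_iff_tendsto_slope' (by simp), zero_smul, add_zero] at h1
    rw [one_mul]
    refine le_of_tendsto h1 ?_
    filter_upwards [self_mem_nhdsWithin] with t ht
    have ht : 0 < t := ht
    have h2 := h x (t • e)
    rw [WithLp.ofLp_smul, lrNorm_smul, abs_of_pos ht, inner_sub_right] at h2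
    simp only [slope, vsub_eq_sub, sub_zero, zero_smul, add_zero, smul_eq_mul]
    rw [inv_mul_le_iff₀ ht]
    exact h2

end Score

/-! ### Second-moment matrices. -/

section Gram

variable {d : ℕ} {S : Type*} [MeasurableSpace S] {μ : Measure S} {v : S → EuclideanSpace ℝ (Fin d)}

lemma integrable_apply_mul_apply (hv : MemLp v 2 μ) (i j : Fin d) :
    Integrable (fun s ↦ v s i * v s j) μ := by
  have h (i : Fin d) : MemLp (fun s ↦ v s i) 2 μ :=
    hv.mono ((EuclideanSpace.proj (𝕜 := ℝ) i).continuous.comp_aestronglyMeasurable hv.1)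
      (.of_forall fun s ↦ PiLp.norm_apply_le (v s) i)
  exact (h i).integrable_mul (h j)

lemma dotProduct_gram_mulVec (hv : MemLp v 2 μ) (t : EuclideanSpace ℝ (Fin d)) :
    dotProduct t.ofLp ((Matrix.of fun i j ↦ ∫ s, v s i * v s j ∂μ).mulVec t.ofLp) =
      ∫ s, (inner ℝ t (v s)) ^ 2 ∂μ := by
  have h1 (s : S) : (inner ℝ t (v s)) ^ 2 = ∑ i, ∑ j, t i * (t j * (v s i * v s j)) := by
    rw [sq, PiLp.inner_apply, Finset.sum_mul_sum]
    refine Finset.sum_congr rfl fun i _ ↦ Finset.sum_congr rfl fun j _ ↦ ?_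
    simp only [RCLike.inner_apply, conj_trivial]
    ring
  have h2 (i j : Fin d) : Integrable (fun s ↦ t i * (t j * (v s i * v s j))) μ :=
    ((integrable_apply_mul_apply hv i j).const_mul _).const_mul _
  simp_rw [h1]
  rw [integral_finsetSum _ fun i _ ↦ integrable_finsetSum _ fun j _ ↦ h2 i j, dotProduct]
  refine Finset.sum_congr rfl fun i _ ↦ ?_
  rw [integral_finsetSum _ fun j _ ↦ h2 i j, Matrix.mulVec, dotProduct, Finset.mul_sum]
  refine Finset.sum_congr rfl fun j _ ↦ ?_
  rw [integral_const_mul, integral_const_mul, Matrix.of_apply]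
  ring

lemma posSemidef_gram (hv : MemLp v 2 μ) :
    (Matrix.of fun i j ↦ ∫ s, v s i * v s j ∂μ : Matrix (Fin d) (Fin d) ℝ).PosSemidef := by
  refine .of_dotProduct_mulVec_nonneg ?_ fun x ↦ ?_
  · ext i j
    simp [mul_comm]
  · have := dotProduct_gram_mulVec hv (WithLp.toLp 2 x)
    simp only [star_trivial]
    rw [this]
    exact integral_nonneg fun s ↦ sq_nonneg _

end Gram

/-! ### Consequences of the logistic model. -/

section Model

variable {d : ℕ} {p q : ℝ≥0∞} {β : EuclideanSpace ℝ (Fin d)}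
  {μ : Measure (EuclideanSpace ℝ (Fin d) × ℝ)}

lemma memLp_fst (hmom : Integrable (fun w ↦ ‖w.1‖ ^ 2) μ) : MemLp (fun w ↦ w.1) 2 μ :=
  (memLp_two_iff_integrable_sq_norm continuous_fst.aestronglyMeasurable).2 hmom

lemma memLp_weighted (hmom : Integrable (fun w ↦ ‖w.1‖ ^ 2) μ) :
    MemLp (fun w ↦ (1 + Real.exp (w.2 * inner ℝ β w.1))⁻¹ • w.1) 2 μ := by
  refine (memLp_fst hmom).mono ?_ (.of_forall fun w ↦ ?_)
  · have h : Continuous fun w : EuclideanSpace ℝ (Fin d) × ℝ ↦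
        1 + Real.exp (w.2 * inner ℝ β w.1) := by fun_prop
    exact ((h.inv₀ fun _ ↦ one_add_exp_ne_zero _).smul continuous_fst).aestronglyMeasurable
  · rw [norm_smul, norm_inv, Real.norm_of_nonneg (by positivity)]
    exact mul_le_of_le_one_left (norm_nonneg _)
      (inv_le_one_of_one_le₀ (by linarith [Real.exp_pos (w.2 * inner ℝ β w.1)]))

/-- The weighted vector differs from the score by the factor `-y`, which squares to `1` only for
labels `±1`; leaving it out makes the identity hold for every `μ`. -/
lemma scoreCov_eq_gram (β : EuclideanSpace ℝ (Fin d))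
    (μ : Measure (EuclideanSpace ℝ (Fin d) × ℝ)) :
    scoreCov β μ = Matrix.of fun i j ↦
      ∫ w, ((1 + Real.exp (w.2 * inner ℝ β w.1))⁻¹ • w.1) i *
        ((1 + Real.exp (w.2 * inner ℝ β w.1))⁻¹ • w.1) j ∂μ := by
  ext i j
  simp only [scoreCov, Matrix.of_apply, PiLp.smul_apply, smul_eq_mul]
  refine integral_congr_ae (.of_forall fun w ↦ ?_)
  have := one_add_exp_ne_zero (w.2 * inner ℝ β w.1)
  simp only
  field_simp

lemma posSemidef_scoreCov (hmom : Integrable (fun w ↦ ‖w.1‖ ^ 2) μ) :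
    (scoreCov β μ).PosSemidef := by
  rw [scoreCov_eq_gram]
  exact posSemidef_gram (memLp_weighted hmom)

lemma posSemidef_secondMoment (hmom : Integrable (fun w ↦ ‖w.1‖ ^ 2) μ) :
    (secondMoment μ).PosSemidef :=
  posSemidef_gram (memLp_fst hmom)

lemma dotProduct_secondMoment_mulVec (hmom : Integrable (fun w ↦ ‖w.1‖ ^ 2) μ)
    (t : EuclideanSpace ℝ (Fin d)) :
    dotProduct t.ofLp ((secondMoment μ).mulVec t.ofLp) = ∫ w, (inner ℝ t w.1) ^ 2 ∂μ :=
  dotProduct_gram_mulVec (memLp_fst hmom) t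

variable [IsProbabilityMeasure μ]

lemma IsLogisticModel.ae_abs_label (hμ : IsLogisticModel β μ) : ∀ᵐ w ∂μ, |w.2| = 1 := by
  filter_upwards [hμ.label] with w hw
  rcases hw with h | h <;> simp [h]

lemma IsLogisticModel.memLp_score (hμ : IsLogisticModel β μ)
    (hmom : Integrable (fun w ↦ ‖w.1‖ ^ 2) μ) : MemLp (fun w ↦ score β w.1 w.2) 2 μ := by
  refine (memLp_fst hmom).mono (continuous_score β).aestronglyMeasurable ?_
  filter_upwards [hμ.ae_abs_label] with w hw
  simpa [hw] using norm_score_le β w.1 w.2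

lemma IsLogisticModel.dotProduct_scoreCov_mulVec (hμ : IsLogisticModel β μ)
    (hmom : Integrable (fun w ↦ ‖w.1‖ ^ 2) μ) (t : EuclideanSpace ℝ (Fin d)) :
    dotProduct t.ofLp ((scoreCov β μ).mulVec t.ofLp) =
      ∫ w, (inner ℝ t (score β w.1 w.2)) ^ 2 ∂μ := by
  rw [scoreCov_eq_gram, dotProduct_gram_mulVec (memLp_weighted hmom)]
  refine integral_congr_ae ?_
  filter_upwards [hμ.ae_abs_label] with w hw
  have h : w.2 ^ 2 = 1 := by rw [← sq_abs, hw, one_pow]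
  simp only [score, inner_smul_right, mul_pow, div_pow, neg_sq, h, inv_pow, one_div]

/-- The log-odds fix the mass at `1`; the support condition gives the rest to `-1`. -/
lemma IsLogisticModel.ae_condKernel (hμ : IsLogisticModel β μ) :
    ∀ᵐ x ∂μ.fst,
      (μ.condKernel x).real {1} = Real.exp (inner ℝ β x) / (1 + Real.exp (inner ℝ β x)) ∧
      (μ.condKernel x).real {-1} = 1 / (1 + Real.exp (inner ℝ β x)) ∧
      ∀ᵐ y ∂μ.condKernel x, y = -1 ∨ y = 1 := by
  have h1 : ∀ᵐ w ∂(μ.fst ⊗ₘ μ.condKernel), w.2 = -1 ∨ w.2 = 1 := by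
    rw [μ.disintegrate μ.condKernel]
    exact hμ.label
  filter_upwards [Measure.ae_ae_of_ae_compProd h1, hμ.logOdds] with x hx ⟨h0, h2, h3⟩
  set a := (μ.condKernel x).real {1} with ha
  have h4 : (μ.condKernel x).real {-1} + a = 1 := by
    have : (μ.condKernel x).real ({-1} ∪ {1}) = 1 := by
      rw [measureReal_def, (prob_compl_eq_zero_iff (by measurability)).1, ENNReal.toReal_one]
      exact hx
    rwa [measureReal_union (by norm_num) (by measurability)] at this
  have h5 : a / (1 - a) = Real.exp (inner ℝ β x) := by
    rw [← h3, Real.exp_log (div_pos h0 (by linarith))]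
  have h6 : 1 - a ≠ 0 := by linarith
  rw [← h5]
  refine ⟨?_, ?_, hx⟩
  · field_simp
    ring
  · rw [← eq_sub_iff_add_eq] at h4
    rw [h4]
    field_simp
    ring

/-- Already the conditional mean given `x` vanishes: the contributions of the two labels cancel. -/
lemma IsLogisticModel.integral_score (hμ : IsLogisticModel β μ)
    (hmom : Integrable (fun w ↦ ‖w.1‖ ^ 2) μ) : ∫ w, score β w.1 w.2 ∂μ = 0 := by
  have hint : Integrable (fun w ↦ score β w.1 w.2) (μ.fst ⊗ₘ μ.condKernel) := by
    rw [μ.disintegrate μ.condKernel]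
    exact (hμ.memLp_score hmom).integrable (by norm_num)
  rw [← μ.disintegrate μ.condKernel, Measure.integral_compProd hint]
  refine integral_eq_zero_of_ae ?_
  filter_upwards [hμ.ae_condKernel] with x ⟨h1, h2, h3⟩
  have h4 : (μ.condKernel x).restrict (({-1, 1} : Finset ℝ) : Set ℝ) = μ.condKernel x :=
    Measure.restrict_eq_self_of_ae_mem (by simpa using h3)
  rw [← h4, setIntegral_finset _ IntegrableOn.finset, Finset.sum_pair (by norm_num), h1, h2]
  simp only [score, smul_smul, ← add_smul, Pi.zero_apply]
  refine smul_eq_zero_of_left ?_ x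
  have := one_add_exp_ne_zero (inner ℝ β x)
  have := one_add_exp_ne_zero (-inner ℝ β x)
  have h5 : Real.exp (inner ℝ β x) * Real.exp (-inner ℝ β x) = 1 := by
    rw [← Real.exp_add]; simp
  simp only [neg_mul, one_mul, neg_neg]
  field_simp
  linear_combination -h5

/-- Turns the essential supremum into a supremum, and later guarantees sample points in each region.
A positive density makes Lebesgue measure absolutely continuous with respect to the law of `X`, and
both labels have positive conditional probability. -/
lemma IsLogisticModel.measure_prod_pos (hμ : IsLogisticModel β μ)
    {U : Set (EuclideanSpace ℝ (Fin d))} (hU : IsOpen U) (hne : U.Nonempty) {y : ℝ}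
    (hy : y = -1 ∨ y = 1) : 0 < μ (U ×ˢ {y}) := by
  rw [← μ.disintegrate μ.condKernel,
    Measure.compProd_apply_prod hU.measurableSet (measurableSet_singleton y),
    setLIntegral_pos_iff (Kernel.measurable_coe _ (measurableSet_singleton y))]
  have h1 : 0 < μ.fst U := by
    obtain ⟨f, hf, hμf, hpos⟩ := hμ.density
    rw [hμf]
    refine pos_iff_ne_zero.2 fun h0 ↦ (hU.measure_pos volume hne).ne' ?_
    exact withDensity_absolutelyContinuous' hf.aemeasurable (hpos.mono fun _ h ↦ h.ne') h0
  refine h1.trans_le (measure_mono_ae ?_)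
  filter_upwards [hμ.ae_condKernel] with x ⟨h2, h3, _⟩ hx
  refine ⟨fun h0 ↦ ?_, hx⟩
  rcases hy with rfl | rfl
  · rw [measureReal_def, show μ.condKernel x {-1} = 0 from h0] at h3
    exact (by positivity : (0 : ℝ) < 1 / (1 + Real.exp (inner ℝ β x))).ne h3
  · rw [measureReal_def, show μ.condKernel x {1} = 0 from h0] at h2
    exact (by positivity : (0 : ℝ) < Real.exp (inner ℝ β x) / (1 + Real.exp (inner ℝ β x))).ne h2

lemma IsLogisticModel.mem_dualSet_iff (hμ : IsLogisticModel β μ) (hp : Fact (1 ≤ p))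
    {ξ : EuclideanSpace ℝ (Fin d)} :
    ξ ∈ dualSet p β μ ↔
      ∀ y : ℝ, y = -1 ∨ y = 1 → ∀ x, lrNorm p (scoreGrad β ξ x y).ofLp ≤ 1 := by
  have hcont : Continuous fun w : EuclideanSpace ℝ (Fin d) × ℝ ↦
      lrNorm p (scoreGrad β ξ w.1 w.2).ofLp :=
    (continuous_lrNorm p).comp ((PiLp.continuous_ofLp 2 _).comp (continuous_scoreGrad β ξ))
  simp only [dualSet, Set.mem_ofPred_eq, vecMul_scoreJacobian]
  generalize hG : (fun w : EuclideanSpace ℝ (Fin d) × ℝ ↦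
    lrNorm p (scoreGrad β ξ w.1 w.2).ofLp) = G at hcont
  have hG' (w : EuclideanSpace ℝ (Fin d) × ℝ) :
    lrNorm p (scoreGrad β ξ w.1 w.2).ofLp = G w := congrFun hG w
  have hG2 (x : EuclideanSpace ℝ (Fin d)) (y : ℝ) :
    lrNorm p (scoreGrad β ξ x y).ofLp = G (x, y) := hG' (x, y)
  simp only [hG', hG2]
  constructor
  · intro h y hy x
    by_contra! hlt
    have hae : ∀ᵐ w ∂μ, G w ≤ 1 := by
      filter_upwards [ENNReal.ae_le_essSup (fun w ↦ ENNReal.ofReal (G w))] with w hw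
      exact ENNReal.ofReal_le_one.1 (hw.trans h)
    have hopen : IsOpen {x' : EuclideanSpace ℝ (Fin d) | 1 < G (x', y)} :=
      isOpen_lt continuous_const (by fun_prop)
    refine (hμ.measure_prod_pos hopen ⟨x, hlt⟩ hy).ne' (measure_mono_null ?_ (ae_iff.1 hae))
    rintro ⟨x', y'⟩ ⟨hx', rfl⟩
    simpa using hx'
  · intro h
    refine essSup_le_of_ae_le _ ?_
    filter_upwards [hμ.label] with w hw
    exact ENNReal.ofReal_le_one.2 (h w.2 hw w.1)

lemma IsLogisticModel.mem_dualSet_iff_lipschitz (hμ : IsLogisticModel β μ)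
    (hpq : p.HolderConjugate q) {ξ : EuclideanSpace ℝ (Fin d)} :
    ξ ∈ dualSet p β μ ↔ ∀ y : ℝ, y = -1 ∨ y = 1 → ∀ x e,
      inner ℝ ξ (score β (x + e) y - score β x y) ≤ lrNorm q e.ofLp := by
  rw [hμ.mem_dualSet_iff (fact_one_le_left hpq)]
  simp_rw [lrNorm_scoreGrad_le_one_iff hpq]

lemma IsLogisticModel.lrNorm_le_two (hμ : IsLogisticModel β μ) (hp : Fact (1 ≤ p))
    {ξ : EuclideanSpace ℝ (Fin d)} (hξ : ξ ∈ dualSet p β μ) : lrNorm p ξ.ofLp ≤ 2 := by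
  -- At `x = 0` the gradient is `-(y/2) ξ`.
  have h := (hμ.mem_dualSet_iff hp).1 hξ (-1) (.inl rfl) 0
  simp only [scoreGrad, inner_zero_right, mul_zero, Real.exp_zero, zero_smul, add_zero, neg_neg,
    WithLp.ofLp_smul, lrNorm_smul] at h
  rw [abs_of_pos (by norm_num)] at h
  linarith

lemma IsLogisticModel.exists_norm_le_of_mem_dualSet (hμ : IsLogisticModel β μ) (hp : Fact (1 ≤ p)) :
    ∃ R : ℝ, 0 ≤ R ∧ ∀ ξ ∈ dualSet p β μ, ‖ξ‖ ≤ R := by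
  obtain ⟨C, hC, h⟩ := exists_norm_le_mul_lrNorm p d
  exact ⟨C * 2, by positivity, fun ξ hξ ↦ (h ξ).trans (by gcongr; exact hμ.lrNorm_le_two hp hξ)⟩

lemma IsLogisticModel.zero_mem_dualSet (hμ : IsLogisticModel β μ) (hp : Fact (1 ≤ p)) :
    (0 : EuclideanSpace ℝ (Fin d)) ∈ dualSet p β μ := by
  rw [hμ.mem_dualSet_iff hp]
  intro y _ x
  simp [scoreGrad, lrNorm_zero]

lemma IsLogisticModel.bddAbove_inner_dualSet (hμ : IsLogisticModel β μ) (hp : Fact (1 ≤ p))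
    (z : EuclideanSpace ℝ (Fin d)) : BddAbove ((fun ξ ↦ inner ℝ ξ z) '' dualSet p β μ) := by
  obtain ⟨R, -, h⟩ := hμ.exists_norm_le_of_mem_dualSet hp
  refine ⟨R * ‖z‖, ?_⟩
  rintro _ ⟨ξ, hξ, rfl⟩
  exact (real_inner_le_norm ξ z).trans (by gcongr; exact h ξ hξ)

lemma IsLogisticModel.inner_le_limitFun (hμ : IsLogisticModel β μ) (hp : Fact (1 ≤ p))
    {ξ : EuclideanSpace ℝ (Fin d)} (hξ : ξ ∈ dualSet p β μ) (z : EuclideanSpace ℝ (Fin d)) :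
    inner ℝ ξ z ≤ limitFun p β μ z :=
  le_csSup (hμ.bddAbove_inner_dualSet hp z) ⟨ξ, hξ, rfl⟩

lemma IsLogisticModel.limitFun_le (hμ : IsLogisticModel β μ) (hp : Fact (1 ≤ p))
    {z : EuclideanSpace ℝ (Fin d)} {c : ℝ} (h : ∀ ξ ∈ dualSet p β μ, inner ℝ ξ z ≤ c) :
    limitFun p β μ z ≤ c := by
  refine csSup_le ⟨_, 0, hμ.zero_mem_dualSet hp, rfl⟩ ?_
  rintro _ ⟨ξ, hξ, rfl⟩
  exact h ξ hξ

lemma IsLogisticModel.limitFun_nonneg (hμ : IsLogisticModel β μ) (hp : Fact (1 ≤ p))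
    (z : EuclideanSpace ℝ (Fin d)) : 0 ≤ limitFun p β μ z := by
  simpa using hμ.inner_le_limitFun hp (hμ.zero_mem_dualSet hp) z

/-- A support function of a bounded set is Lipschitz; this is the continuity needed for the
continuous mapping theorem. -/
lemma IsLogisticModel.exists_lipschitzWith_limitFun (hμ : IsLogisticModel β μ)
    (hp : Fact (1 ≤ p)) : ∃ K, LipschitzWith K (limitFun p β μ) := by
  obtain ⟨R, hR, h⟩ := hμ.exists_norm_le_of_mem_dualSet hp
  refine ⟨R.toNNReal, LipschitzWith.of_le_add_mul _ fun z z' ↦ ?_⟩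
  refine hμ.limitFun_le hp fun ξ hξ ↦ ?_
  calc inner ℝ ξ z = inner ℝ ξ z' + inner ℝ ξ (z - z') := by rw [← inner_add_right]; simp
    _ ≤ limitFun p β μ z' + R * dist z z' := by
      gcongr
      · exact hμ.inner_le_limitFun hp hξ z'
      · rw [dist_eq_norm]
        exact (real_inner_le_norm _ _).trans (by gcongr; exact h ξ hξ)
    _ = _ := by rw [Real.coe_toNNReal R hR]

end Model

/-! ### Empirical measures and their couplings. -/

section Empirical

variable {S : Type*} [MeasurableSpace S]

lemma isProbabilityMeasure_inv_smul_sum {n : ℕ} (hn : 1 ≤ n) (ν : ℕ → Measure S)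
    [∀ i, IsProbabilityMeasure (ν i)] :
    IsProbabilityMeasure ((n : ℝ≥0∞)⁻¹ • ∑ i ∈ Finset.range n, ν i) := by
  refine ⟨?_⟩
  simp only [Measure.smul_apply, Measure.finsetSum_apply, measure_univ, Finset.sum_const,
    Finset.card_range, smul_eq_mul, nsmul_eq_mul, mul_one]
  exact ENNReal.inv_mul_cancel (by exact_mod_cast (by omega : n ≠ 0)) (by simp)

lemma lintegral_inv_smul_sum (n : ℕ) (ν : ℕ → Measure S) (f : S → ℝ≥0∞) :
    ∫⁻ s, f s ∂((n : ℝ≥0∞)⁻¹ • ∑ i ∈ Finset.range n, ν i) =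
      (n : ℝ≥0∞)⁻¹ * ∑ i ∈ Finset.range n, ∫⁻ s, f s ∂ν i := by
  rw [lintegral_smul_measure, lintegral_finsetSum_measure, smul_eq_mul]

lemma lintegral_empirical [MeasurableSingletonClass S] (n : ℕ) (w : ℕ → S) (f : S → ℝ≥0∞) :
    ∫⁻ s, f s ∂(empirical n w) = (n : ℝ≥0∞)⁻¹ * ∑ i ∈ Finset.range n, f (w i) := by
  simp [empirical]

lemma integrable_empirical [MeasurableSingletonClass S] {F : Type*} [NormedAddCommGroup F]
    {n : ℕ} (hn : 1 ≤ n) (w : ℕ → S) (f : S → F) : Integrable f (empirical n w) := by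
  refine Integrable.smul_measure ?_ (by simp; omega)
  rw [integrable_finsetSum_measure]
  exact fun i _ ↦ integrable_dirac (by simp)

lemma integral_empirical [MeasurableSingletonClass S] {F : Type*} [NormedAddCommGroup F]
    [NormedSpace ℝ F] [CompleteSpace F] (n : ℕ) (w : ℕ → S) (f : S → F) :
    ∫ s, f s ∂(empirical n w) = (n : ℝ)⁻¹ • ∑ i ∈ Finset.range n, f (w i) := by
  rw [empirical, integral_smul_measure,
    integral_finsetSum_measure fun i _ ↦ integrable_dirac (by simp)]
  simp

instance isProbabilityMeasure_empirical {n : ℕ} [NeZero n] (w : ℕ → S) :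
    IsProbabilityMeasure (empirical n w) :=
  isProbabilityMeasure_inv_smul_sum (NeZero.one_le) _

/-- A coupling with an empirical measure is a mixture over the atoms. -/
lemma exists_lintegral_eq_of_snd_eq_empirical [MeasurableSingletonClass S] [StandardBorelSpace S]
    [Nonempty S] {n : ℕ} (hn : 1 ≤ n) {w : ℕ → S} {π : Measure (S × S)}
    (hπ : π.snd = empirical n w) :
    ∃ κ : ℕ → Measure S, (∀ i, IsProbabilityMeasure (κ i)) ∧ ∀ f : S × S → ℝ≥0∞, Measurable f →
      ∫⁻ z, f z ∂π = (n : ℝ≥0∞)⁻¹ * ∑ i ∈ Finset.range n, ∫⁻ u, f (u, w i) ∂κ i := by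
  have : NeZero n := ⟨by omega⟩
  have hfin : IsProbabilityMeasure π := by
    refine ⟨?_⟩
    rw [← Measure.snd_univ, hπ, measure_univ]
  -- Disintegration conditions on the first coordinate, so the empirical marginal is put there.
  set ρ := π.map Prod.swap with hρ
  have : IsProbabilityMeasure ρ := Measure.isProbabilityMeasure_map measurable_swap.aemeasurable
  refine ⟨fun i ↦ ρ.condKernel (w i), fun i ↦ inferInstance, fun f hf ↦ ?_⟩
  have h1 : ∫⁻ z, f z ∂π = ∫⁻ z, f z.swap ∂ρ := by
    rw [hρ, lintegral_map (f := fun z : S × S ↦ f z.swap) (hf.comp measurable_swap) measurable_swap]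
    simp
  have hfst : ρ.fst = empirical n w := by rw [hρ, Measure.fst_map_swap, hπ]
  have h2 := Measure.lintegral_compProd (μ := ρ.fst) (κ := ρ.condKernel)
    (f := fun z ↦ f z.swap) (hf.comp measurable_swap)
  rw [ρ.disintegrate ρ.condKernel, hfst, lintegral_empirical] at h2
  rw [h1, h2]
  simp

end Empirical

/-! ### Transport cost, attainable means and weak duality. -/

section Transport

variable {d : ℕ} {p q : ℝ≥0∞} {β : EuclideanSpace ℝ (Fin d)}

lemma measurable_costN (q : ℝ≥0∞) [Fact (1 ≤ q)] :
    Measurable fun z : (EuclideanSpace ℝ (Fin d) × ℝ) × (EuclideanSpace ℝ (Fin d) × ℝ) ↦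
      costN q z.1 z.2 := by
  unfold costN
  refine Measurable.ite (measurableSet_eq_fun (by fun_prop) (by fun_prop)) ?_ measurable_const
  refine ENNReal.measurable_ofReal.comp (Continuous.measurable ?_)
  exact (continuous_lrNorm q).comp ((PiLp.continuous_ofLp 2 _).comp (by fun_prop))

lemma costN_le_add [Fact (1 ≤ q)] (u : EuclideanSpace ℝ (Fin d) × ℝ)
    (x x' : EuclideanSpace ℝ (Fin d)) (y : ℝ) :
    costN q u (x', y) ≤ costN q u (x, y) + ENNReal.ofReal (lrNorm q (x - x').ofLp) := by
  unfold costN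
  by_cases h : u.2 = y
  · simp only [h, if_true]
    rw [← ENNReal.ofReal_add (lrNorm_nonneg _ _) (lrNorm_nonneg _ _)]
    refine ENNReal.ofReal_le_ofReal ?_
    refine le_trans (le_of_eq ?_) (lrNorm_add_le q _ _)
    congr 1
    rw [← WithLp.ofLp_add]
    congr 1
    abel
  · simp [h]

/-- The values of `E_P[h(X, Y; β)]` over the laws `P` that can be transported to `Q` at cost at
most `c`. -/
def attainable (q : ℝ≥0∞) (β : EuclideanSpace ℝ (Fin d))
    (Q : Measure (EuclideanSpace ℝ (Fin d) × ℝ)) (c : ℝ≥0∞) : Set (EuclideanSpace ℝ (Fin d)) :=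
  {v | ∃ π : Measure ((EuclideanSpace ℝ (Fin d) × ℝ) × (EuclideanSpace ℝ (Fin d) × ℝ)),
    IsProbabilityMeasure π ∧ π.snd = Q ∧ Integrable (fun z ↦ score β z.1.1 z.1.2) π ∧
      ∫ z, score β z.1.1 z.1.2 ∂π = v ∧ ∫⁻ z, costN q z.1 z.2 ∂π ≤ c}

lemma profile_le_of_zero_mem_attainable {Q : Measure (EuclideanSpace ℝ (Fin d) × ℝ)} {c : ℝ≥0∞}
    (h : 0 ∈ attainable q β Q c) : profile q β Q ≤ c := by
  obtain ⟨π, hπ, hsnd, hint, h0, hc⟩ := h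
  have hm : AEStronglyMeasurable (fun w : EuclideanSpace ℝ (Fin d) × ℝ ↦ score β w.1 w.2) π.fst :=
    (continuous_score β).aestronglyMeasurable
  have h1 : Integrable (fun w ↦ score β w.1 w.2) π.fst :=
    (integrable_map_measure hm measurable_fst.aemeasurable).2 hint
  have h2 : ∫ w, score β w.1 w.2 ∂π.fst = 0 := by
    rw [Measure.fst, integral_map measurable_fst.aemeasurable hm, h0]
  refine iInf_le_of_le π.fst <| iInf_le_of_le inferInstance <| iInf_le_of_le h1 <|
    iInf_le_of_le h2 <| iInf_le_of_le π <| iInf_le_of_le rfl <| iInf_le_of_le hsnd hc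

/-- Mixing two couplings with second marginal `Q` keeps that marginal and averages both means and
costs. Splitting mass is thus allowed, which makes the attainable set convex. -/
lemma add_mem_attainable {Q : Measure (EuclideanSpace ℝ (Fin d) × ℝ)} {c₁ c₂ : ℝ≥0∞}
    {v₁ v₂ : EuclideanSpace ℝ (Fin d)} (h₁ : v₁ ∈ attainable q β Q c₁)
    (h₂ : v₂ ∈ attainable q β Q c₂) {a b : ℝ} (ha : 0 ≤ a) (hb : 0 ≤ b) (hab : a + b = 1) :
    a • v₁ + b • v₂ ∈ attainable q β Q (ENNReal.ofReal a * c₁ + ENNReal.ofReal b * c₂) := by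
  obtain ⟨π₁, hπ₁, hsnd₁, hint₁, hv₁, hc₁⟩ := h₁
  obtain ⟨π₂, hπ₂, hsnd₂, hint₂, hv₂, hc₂⟩ := h₂
  have hab' : ENNReal.ofReal a + ENNReal.ofReal b = 1 := by
    rw [← ENNReal.ofReal_add ha hb, hab, ENNReal.ofReal_one]
  have i₁ := hint₁.smul_measure (c := ENNReal.ofReal a) (by simp)
  have i₂ := hint₂.smul_measure (c := ENNReal.ofReal b) (by simp)
  refine ⟨ENNReal.ofReal a • π₁ + ENNReal.ofReal b • π₂, ⟨?_⟩, ?_, ?_, ?_, ?_⟩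
  · simp [hab']
  · rw [Measure.snd, Measure.map_add _ _ measurable_snd, Measure.map_smul, Measure.map_smul,
      ← Measure.snd, ← Measure.snd, hsnd₁, hsnd₂, ← add_smul, hab', one_smul]
  · exact i₁.add_measure i₂
  · rw [integral_add_measure i₁ i₂, integral_smul_measure, integral_smul_measure, hv₁, hv₂,
      ENNReal.toReal_ofReal ha, ENNReal.toReal_ofReal hb]
  · rw [lintegral_add_measure, lintegral_smul_measure, lintegral_smul_measure]
    simp only [smul_eq_mul]
    gcongr

lemma convex_attainable (q : ℝ≥0∞) (β : EuclideanSpace ℝ (Fin d))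
    (Q : Measure (EuclideanSpace ℝ (Fin d) × ℝ)) (c : ℝ≥0∞) :
    Convex ℝ (attainable q β Q c) := by
  intro v₁ h₁ v₂ h₂ a b ha hb hab
  have := add_mem_attainable h₁ h₂ ha hb hab
  rwa [← add_mul, ← ENNReal.ofReal_add ha hb, hab, ENNReal.ofReal_one, one_mul] at this

lemma ofReal_inv_mul_sum {n : ℕ} (hn : 1 ≤ n) {a : ℕ → ℝ} (ha : ∀ i, 0 ≤ a i) :
    (n : ℝ≥0∞)⁻¹ * ∑ i ∈ Finset.range n, ENNReal.ofReal (a i) =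
      ENNReal.ofReal ((n : ℝ)⁻¹ * ∑ i ∈ Finset.range n, a i) := by
  rw [ENNReal.ofReal_mul (by positivity), ENNReal.ofReal_sum_of_nonneg fun i _ ↦ ha i,
    ENNReal.ofReal_inv_of_pos (by positivity), ENNReal.ofReal_natCast]

/-- Moving the atoms of an empirical measure without changing the labels. -/
lemma mem_attainable_empirical [Fact (1 ≤ q)] {n : ℕ} (hn : 1 ≤ n)
    (w : ℕ → EuclideanSpace ℝ (Fin d) × ℝ) (x' : ℕ → EuclideanSpace ℝ (Fin d)) :
    (n : ℝ)⁻¹ • ∑ i ∈ Finset.range n, score β (x' i) (w i).2 ∈ attainable q β (empirical n w)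
      (ENNReal.ofReal ((n : ℝ)⁻¹ * ∑ i ∈ Finset.range n, lrNorm q (x' i - (w i).1).ofLp)) := by
  have : NeZero n := ⟨by omega⟩
  refine ⟨empirical n fun i ↦ ((x' i, (w i).2), w i), inferInstance, ?_, ?_, ?_, ?_⟩
  · ext s hs
    rw [Measure.snd_apply hs, ← lintegral_indicator_one (measurable_snd hs),
      ← lintegral_indicator_one hs, lintegral_empirical, lintegral_empirical]
    rfl
  · exact integrable_empirical hn _ _
  · rw [integral_empirical]
  · rw [lintegral_empirical, ← ofReal_inv_mul_sum hn fun i ↦ lrNorm_nonneg q _]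
    simp [costN]

/-- Moving every atom to `x = 0`, where the score vanishes, has finite cost. -/
lemma profile_empirical_ne_top [Fact (1 ≤ q)] {n : ℕ} (hn : 1 ≤ n)
    (w : ℕ → EuclideanSpace ℝ (Fin d) × ℝ) : profile q β (empirical n w) ≠ ∞ := by
  have h := mem_attainable_empirical (q := q) (β := β) hn w 0
  simp only [Pi.zero_apply, score_zero, Finset.sum_const_zero, smul_zero] at h
  exact ((profile_le_of_zero_mem_attainable h).trans_lt ENNReal.ofReal_lt_top).ne

/-- Weak duality. -/
lemma ofReal_neg_integral_inner_score_le_profile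
    {Q : Measure (EuclideanSpace ℝ (Fin d) × ℝ)} {ξ : EuclideanSpace ℝ (Fin d)}
    (hQ : Integrable (fun w ↦ score β w.1 w.2) Q) (hlabel : ∀ᵐ w ∂Q, w.2 = -1 ∨ w.2 = 1)
    (hξ : ∀ y : ℝ, y = -1 ∨ y = 1 → ∀ x e,
      inner ℝ ξ (score β (x + e) y - score β x y) ≤ lrNorm q e.ofLp) :
    ENNReal.ofReal (-inner ℝ ξ (∫ w, score β w.1 w.2 ∂Q)) ≤ profile q β Q := by
  refine le_iInf fun P ↦ le_iInf fun hP ↦ le_iInf fun hint ↦ le_iInf fun h0 ↦ le_iInf fun π ↦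
    le_iInf fun hfst ↦ le_iInf fun hsnd ↦ ?_
  have hm (ν : Measure (EuclideanSpace ℝ (Fin d) × ℝ)) :
      AEStronglyMeasurable (fun w : EuclideanSpace ℝ (Fin d) × ℝ ↦ score β w.1 w.2) ν :=
    (continuous_score β).aestronglyMeasurable
  have i₁ : Integrable (fun z ↦ score β z.1.1 z.1.2) π := by
    rw [← hfst] at hint
    exact (integrable_map_measure (hm _) measurable_fst.aemeasurable).1 hint
  have i₂ : Integrable (fun z ↦ score β z.2.1 z.2.2) π := by
    rw [← hsnd] at hQ
    exact (integrable_map_measure (hm _) measurable_snd.aemeasurable).1 hQ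
  have e₁ : ∫ z, score β z.1.1 z.1.2 ∂π = 0 := by
    rw [← h0, ← hfst, Measure.fst, integral_map measurable_fst.aemeasurable (hm _)]
  have e₂ : ∫ z, score β z.2.1 z.2.2 ∂π = ∫ w, score β w.1 w.2 ∂Q := by
    rw [← hsnd, Measure.snd, integral_map measurable_snd.aemeasurable (hm _)]
  have e₃ : -inner ℝ ξ (∫ w, score β w.1 w.2 ∂Q) =
      ∫ z, inner ℝ ξ (score β z.1.1 z.1.2 - score β z.2.1 z.2.2) ∂π := by
    have := integral_inner (𝕜 := ℝ) (i₁.sub i₂) ξ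
    simp only [Pi.sub_apply] at this
    rw [this, integral_sub i₁ i₂, e₁, e₂, zero_sub, inner_neg_right]
  have i₃ : Integrable
      (fun z ↦ inner ℝ ξ (score β z.1.1 z.1.2 - score β z.2.1 z.2.2)) π :=
    (i₁.sub i₂).const_inner ξ
  have hl : ∀ᵐ z ∂π, z.2.2 = -1 ∨ z.2.2 = 1 := by
    rw [← hsnd] at hlabel
    exact ae_of_ae_map measurable_snd.aemeasurable hlabel
  calc ENNReal.ofReal (-inner ℝ ξ (∫ w, score β w.1 w.2 ∂Q))
      ≤ ENNReal.ofReal (∫⁻ z, ENNReal.ofReal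
          (inner ℝ ξ (score β z.1.1 z.1.2 - score β z.2.1 z.2.2)) ∂π).toReal := by
        -- Keeping only the positive part leads to a `lintegral`, comparable with a possibly
        -- infinite cost.
        refine ENNReal.ofReal_le_ofReal ?_
        rw [e₃, integral_eq_lintegral_pos_part_sub_lintegral_neg_part i₃]
        exact sub_le_self _ ENNReal.toReal_nonneg
    _ ≤ ∫⁻ z, ENNReal.ofReal
          (inner ℝ ξ (score β z.1.1 z.1.2 - score β z.2.1 z.2.2)) ∂π := ENNReal.ofReal_toReal_le
    _ ≤ ∫⁻ z, costN q z.1 z.2 ∂π := by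
        refine lintegral_mono_ae ?_
        filter_upwards [hl] with z hz
        unfold costN
        split_ifs with h
        · refine ENNReal.ofReal_le_ofReal ?_
          have := hξ z.2.2 hz z.2.1 (z.1.1 - z.2.1)
          rw [add_sub_cancel] at this
          rwa [h]
        · exact le_top

/-- For fixed labels the profile function is Lipschitz in the positions of the atoms. -/
lemma profile_empirical_le_add [Fact (1 ≤ q)] {n : ℕ} (hn : 1 ≤ n)
    (x x' : ℕ → EuclideanSpace ℝ (Fin d)) (y : ℕ → ℝ) :
    profile q β (empirical n fun i ↦ (x' i, y i)) ≤ profile q β (empirical n fun i ↦ (x i, y i)) +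
      ENNReal.ofReal ((n : ℝ)⁻¹ * ∑ i ∈ Finset.range n, lrNorm q (x i - x' i).ofLp) := by
  have hn' : (n : ℝ≥0∞) ≠ 0 := by exact_mod_cast (by omega : n ≠ 0)
  simp only [profile, ENNReal.iInf_add, transportCost]
  refine le_iInf fun P ↦ le_iInf fun hP ↦ le_iInf fun hint ↦ le_iInf fun h0 ↦ le_iInf fun π ↦
    le_iInf fun hfst ↦ le_iInf fun hsnd ↦ ?_
  -- Each atom keeps its conditional law `κ i` but is relocated from `x i` to `x' i`; the first
  -- marginal is unaffected.
  obtain ⟨κ, hκ, hπ⟩ := exists_lintegral_eq_of_snd_eq_empirical hn hsnd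
  set π' := (n : ℝ≥0∞)⁻¹ • ∑ i ∈ Finset.range n, (κ i).map fun u ↦ (u, ((x' i, y i) : _ × ℝ))
    with hπ'
  have hm (i : ℕ) : Measurable fun u : EuclideanSpace ℝ (Fin d) × ℝ ↦
    (u, ((x' i, y i) : EuclideanSpace ℝ (Fin d) × ℝ)) := by fun_prop
  have hlin (f : _ → ℝ≥0∞) (hf : Measurable f) : ∫⁻ z, f z ∂π' =
      (n : ℝ≥0∞)⁻¹ * ∑ i ∈ Finset.range n, ∫⁻ u, f (u, (x' i, y i)) ∂κ i := by
    rw [hπ', lintegral_inv_smul_sum]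
    simp_rw [lintegral_map hf (hm _)]
  have hfst' : π'.fst = P := by
    rw [← hfst]
    ext s hs
    rw [Measure.fst_apply hs, Measure.fst_apply hs, ← lintegral_indicator_one (measurable_fst hs),
      ← lintegral_indicator_one (measurable_fst hs),
      hlin _ (measurable_one.indicator (measurable_fst hs)),
      hπ _ (measurable_one.indicator (measurable_fst hs))]
    rfl
  have hsnd' : π'.snd = empirical n fun i ↦ (x' i, y i) := by
    ext s hs
    rw [Measure.snd_apply hs, ← lintegral_indicator_one (measurable_snd hs),
      ← lintegral_indicator_one hs, hlin _ (measurable_one.indicator (measurable_snd hs)),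
      lintegral_empirical]
    congr 1
    refine Finset.sum_congr rfl fun i _ ↦ ?_
    have (u : EuclideanSpace ℝ (Fin d) × ℝ) :
      (Prod.snd ⁻¹' s).indicator (fun _ ↦ (1 : ℝ≥0∞)) (u, (x' i, y i)) =
        s.indicator (fun _ ↦ 1) (x' i, y i) := rfl
    simp [Pi.one_def, this]
  refine iInf_le_of_le P <| iInf_le_of_le hP <| iInf_le_of_le hint <| iInf_le_of_le h0 <|
    iInf_le_of_le π' <| iInf_le_of_le hfst' <| iInf_le_of_le hsnd' ?_
  rw [hlin _ (measurable_costN q), hπ _ (measurable_costN q),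
    ← ofReal_inv_mul_sum hn fun i ↦ lrNorm_nonneg q _, ← mul_add, ← Finset.sum_add_distrib]
  gcongr with i
  calc ∫⁻ u, costN q u (x' i, y i) ∂κ i
      ≤ ∫⁻ u, (costN q u (x i, y i) + ENNReal.ofReal (lrNorm q (x i - x' i).ofLp)) ∂κ i :=
        lintegral_mono fun u ↦ costN_le_add u (x i) (x' i) (y i)
    _ = _ := by
        rw [lintegral_add_right _ measurable_const]
        simp

end Transport

/-! ### Upper bound by profitable moves and separation. -/

section UpperBound

variable {d : ℕ} {p q : ℝ≥0∞} {β : EuclideanSpace ℝ (Fin d)}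

lemma attainable_mono {Q : Measure (EuclideanSpace ℝ (Fin d) × ℝ)} {c c' : ℝ≥0∞} (h : c ≤ c') :
    attainable q β Q c ⊆ attainable q β Q c' :=
  fun _ ⟨π, h₁, h₂, h₃, h₄, h₅⟩ ↦ ⟨π, h₁, h₂, h₃, h₄, h₅.trans h⟩

/-- If `ζ` keeps a positive distance from the dual set, then one of finitely many moves is
profitable for `ζ`, uniformly over an open set of starting points. -/
lemma IsLogisticModel.exists_moves {μ : Measure (EuclideanSpace ℝ (Fin d) × ℝ)}
    [IsProbabilityMeasure μ] (hμ : IsLogisticModel β μ) (hpq : p.HolderConjugate q) {r : ℝ}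
    (hr : 0 < r) :
    ∃ (t : Finset (EuclideanSpace ℝ (Fin d)))
      (U : EuclideanSpace ℝ (Fin d) → Set (EuclideanSpace ℝ (Fin d)))
      (y : EuclideanSpace ℝ (Fin d) → ℝ) (e : EuclideanSpace ℝ (Fin d) → EuclideanSpace ℝ (Fin d)),
      (∀ k ∈ t, IsOpen (U k) ∧ (U k).Nonempty ∧ (y k = -1 ∨ y k = 1) ∧
        0 < lrNorm q (e k).ofLp) ∧
      ∀ ζ, (∀ ξ ∈ dualSet p β μ, r ≤ ‖ζ - ξ‖) → ∃ k ∈ t, ∀ x ∈ U k,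
        lrNorm q (e k).ofLp ≤ inner ℝ ζ (score β (x + e k) (y k) - score β x (y k)) := by
  have hp := fact_one_le_left hpq
  have hq := fact_one_le_right hpq
  obtain ⟨R, hR, hA⟩ := hμ.exists_norm_le_of_mem_dualSet hp
  -- With `dualSet` inside the ball of radius `R`, the sphere of radius `R + r` is at distance at
  -- least `r` from it, so larger `ζ` can be rescaled into `S`.
  set S : Set (EuclideanSpace ℝ (Fin d)) :=
    Metric.closedBall 0 (R + r) ∩ ⋂ ξ ∈ dualSet p β μ, {ζ | r ≤ ‖ζ - ξ‖} with hS
  have hcompact : IsCompact S := by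
    refine (isCompact_closedBall _ _).inter_right (isClosed_biInter fun ξ _ ↦ ?_)
    exact isClosed_le continuous_const (by fun_prop)
  have key : ∀ ζ ∈ S, ∃ (N U : Set (EuclideanSpace ℝ (Fin d))) (y : ℝ)
      (e : EuclideanSpace ℝ (Fin d)), N ∈ 𝓝 ζ ∧ IsOpen U ∧ U.Nonempty ∧ (y = -1 ∨ y = 1) ∧
      0 < lrNorm q e.ofLp ∧ ∀ ζ' ∈ N, ∀ x ∈ U,
        lrNorm q e.ofLp ≤ inner ℝ ζ' (score β (x + e) y - score β x y) := by
    intro ζ hζ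
    have hnot : ζ ∉ dualSet p β μ := fun h ↦ by
      have := Set.mem_iInter₂.1 hζ.2 ζ h
      simp only [sub_self, norm_zero, Set.mem_ofPred_eq] at this
      linarith
    rw [hμ.mem_dualSet_iff_lipschitz hpq] at hnot
    push Not at hnot
    obtain ⟨y, hy, x, e, hlt⟩ := hnot
    have hs (e : EuclideanSpace ℝ (Fin d)) : Continuous fun x ↦ score β (x + e) y :=
      (continuous_score β).comp (by fun_prop : Continuous fun x ↦ (x + e, y))
    have hopen : IsOpen {z : EuclideanSpace ℝ (Fin d) × EuclideanSpace ℝ (Fin d) |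
        lrNorm q e.ofLp < inner ℝ z.1 (score β (z.2 + e) y - score β z.2 y)} := by
      refine isOpen_lt continuous_const (continuous_fst.inner (Continuous.sub ?_ ?_))
      · exact (hs e).comp continuous_snd
      · exact (continuous_score β).comp (continuous_snd.prodMk continuous_const)
    obtain ⟨N, U, hN, hU, hζN, hxU, hsub⟩ := isOpen_prod_iff.1 hopen ζ x hlt
    refine ⟨N, U, y, e, hN.mem_nhds hζN, hU, ⟨x, hxU⟩, hy, ?_, fun ζ' h' x' hx' ↦
      (hsub (Set.mk_mem_prod h' hx')).le⟩
    refine lrNorm_pos fun h0 ↦ ?_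
    have : e = 0 := by ext i; simp [h0]
    simp [this, lrNorm_zero] at hlt
  choose! N U y e hN hU hUne hy he hmove using key
  obtain ⟨t, htS, hcover⟩ := hcompact.elim_nhds_subcover N hN
  refine ⟨t, U, y, e, fun k hk ↦ ⟨hU k (htS k hk), hUne k (htS k hk), hy k (htS k hk),
    he k (htS k hk)⟩, fun ζ hζ ↦ ?_⟩
  rcases le_or_gt ‖ζ‖ (R + r) with h | h
  · obtain ⟨k, hk, hkN⟩ := Set.mem_iUnion₂.1
      (hcover ⟨mem_closedBall_zero_iff.2 h, Set.mem_iInter₂.2 hζ⟩)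
    exact ⟨k, hk, hmove k (htS k hk) ζ hkN⟩
  · have hpos : 0 < ‖ζ‖ := by linarith
    set a := (R + r) / ‖ζ‖ with ha
    have ha0 : 0 < a := by positivity
    have ha1 : a ≤ 1 := (div_le_one hpos).2 h.le
    have hnorm : ‖a • ζ‖ = R + r := by
      rw [norm_smul, Real.norm_of_nonneg ha0.le, ha, div_mul_cancel₀ _ hpos.ne']
    have hmem : a • ζ ∈ S := by
      refine ⟨mem_closedBall_zero_iff.2 hnorm.le, Set.mem_iInter₂.2 fun ξ hξ ↦ ?_⟩
      have := norm_sub_norm_le (a • ζ) ξ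
      have := hA ξ hξ
      simp only [Set.mem_ofPred_eq]
      linarith
    obtain ⟨k, hk, hkN⟩ := Set.mem_iUnion₂.1 (hcover hmem)
    refine ⟨k, hk, fun x hx ↦ ?_⟩
    have h1 := hmove k (htS k hk) _ hkN x hx
    have h2 := he k (htS k hk)
    -- The gain of `a • ζ` is `a ≤ 1` times that of `ζ`, and it is positive, so `ζ` gains at least
    -- as much.
    rw [real_inner_smul_left] at h1
    refine h1.trans (mul_le_of_le_one_left ?_ ha1)
    exact (pos_of_mul_pos_right (h2.trans_le h1) ha0.le).le

/-- If every direction `ζ` with `⟪ζ, E_n h⟫ = -C` admits a profitable move for which enough sample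
points are available, then the profile function is at most `C`. -/
lemma profile_empirical_le_of_moves [Fact (1 ≤ q)] {κ : Type*} {t : Finset κ}
    {U : κ → Set (EuclideanSpace ℝ (Fin d))}
    {y : κ → ℝ} {e : κ → EuclideanSpace ℝ (Fin d)} (he : ∀ k ∈ t, 0 < lrNorm q (e k).ofLp)
    {n : ℕ} (hn : 1 ≤ n) {w : ℕ → EuclideanSpace ℝ (Fin d) × ℝ} {η C : ℝ} (hη : 0 < η) (hC : 0 < C)
    (hfrac : ∀ k ∈ t,
      η ≤ (∑ i ∈ Finset.range n, (U k ×ˢ {y k}).indicator (fun _ ↦ (1 : ℝ)) (w i)) / n)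
    (hCη : ∀ k ∈ t, C ≤ η * lrNorm q (e k).ofLp)
    (hmove : ∀ ζ, inner ℝ ζ ((n : ℝ)⁻¹ • ∑ i ∈ Finset.range n, score β (w i).1 (w i).2) = -C →
      ∃ k ∈ t, ∀ x ∈ U k,
        lrNorm q (e k).ofLp ≤ inner ℝ ζ (score β (x + e k) (y k) - score β x (y k))) :
    profile q β (empirical n w) ≤ ENNReal.ofReal C := by
  classical
  have hn0 : (0 : ℝ) < n := by exact_mod_cast hn
  set M := (n : ℝ)⁻¹ • ∑ i ∈ Finset.range n, score β (w i).1 (w i).2 with hM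
  set f : κ → ℝ := fun k ↦
    (∑ i ∈ Finset.range n, (U k ×ˢ {y k}).indicator (fun _ ↦ (1 : ℝ)) (w i)) / n with hf
  set x' : κ → ℕ → EuclideanSpace ℝ (Fin d) := fun k i ↦
    if w i ∈ U k ×ˢ {y k} then (w i).1 + e k else (w i).1 with hx'
  set V : κ → EuclideanSpace ℝ (Fin d) := fun k ↦
    (n : ℝ)⁻¹ • ∑ i ∈ Finset.range n, score β (x' k i) (w i).2 with hV
  -- The share of move `k` to carry out, chosen so that the cost is exactly `C`; enough sample
  -- points in the region make it at most `1`.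
  set a : κ → ℝ := fun k ↦ C / (f k * lrNorm q (e k).ofLp) with ha
  have hfpos : ∀ k ∈ t, 0 < f k := fun k hk ↦ hη.trans_le (hfrac k hk)
  have hprod : ∀ k ∈ t, 0 < f k * lrNorm q (e k).ofLp := fun k hk ↦ mul_pos (hfpos k hk) (he k hk)
  have ha0 : ∀ k ∈ t, 0 < a k := fun k hk ↦ div_pos hC (hprod k hk)
  have ha1 : ∀ k ∈ t, a k ≤ 1 := fun k hk ↦ by
    rw [ha, div_le_one (hprod k hk)]
    refine (hCη k hk).trans ?_
    have := (he k hk).le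
    gcongr
    exact hfrac k hk
  have haf : ∀ k ∈ t, a k * (f k * lrNorm q (e k).ofLp) = C := fun k hk ↦
    div_mul_cancel₀ _ (hprod k hk).ne'
  have hM0 : M ∈ attainable q β (empirical n w) 0 := by
    simpa [lrNorm_zero] using mem_attainable_empirical (q := q) (β := β) hn w fun i ↦ (w i).1
  have hVmem : ∀ k, V k ∈ attainable q β (empirical n w)
      (ENNReal.ofReal (f k * lrNorm q (e k).ofLp)) := by
    intro k
    have hcost : f k * lrNorm q (e k).ofLp =
        (n : ℝ)⁻¹ * ∑ i ∈ Finset.range n, lrNorm q (x' k i - (w i).1).ofLp := by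
      rw [hf, div_mul_eq_mul_div, div_eq_inv_mul, Finset.sum_mul]
      refine congrArg _ (Finset.sum_congr rfl fun i _ ↦ ?_)
      by_cases h : w i ∈ U k ×ˢ {y k}
      · simp only [hx', if_pos h, Set.indicator_of_mem h, one_mul, add_sub_cancel_left]
      · simp only [hx', if_neg h, Set.indicator_of_notMem h, zero_mul, sub_self, WithLp.ofLp_zero,
          lrNorm_zero]
    rw [hcost]
    exact mem_attainable_empirical hn w (x' k)
  set v : κ → EuclideanSpace ℝ (Fin d) := fun k ↦ (1 - a k) • M + a k • V k with hv
  have hvmem : ∀ k ∈ t, v k ∈ attainable q β (empirical n w) (ENNReal.ofReal C) := by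
    intro k hk
    have := add_mem_attainable hM0 (hVmem k) (sub_nonneg.2 (ha1 k hk)) (ha0 k hk).le (by ring)
    rwa [mul_zero, zero_add, ← ENNReal.ofReal_mul (ha0 k hk).le, haf k hk] at this
  -- Including `M` makes the separating functional positive at `M`, so it can be normalized.
  set F : Set (EuclideanSpace ℝ (Fin d)) := insert M (v '' t) with hF
  have hFfin : F.Finite := (t.finite_toSet.image v).insert M
  have hsub : convexHull ℝ F ⊆ attainable q β (empirical n w) (ENNReal.ofReal C) := by
    refine convexHull_min ?_ (convex_attainable _ _ _ _)
    rintro _ (rfl | ⟨k, hk, rfl⟩)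
    · exact attainable_mono zero_le hM0
    · exact hvmem k hk
  refine profile_le_of_zero_mem_attainable (hsub ?_)
  by_contra h0
  obtain ⟨φ, u, h0u, hφ⟩ := geometric_hahn_banach_point_closed (convex_convexHull ℝ F)
    (hFfin.isClosed_convexHull ℝ) h0
  rw [map_zero] at h0u
  have hpos : ∀ b ∈ F, 0 < φ b := fun b hb ↦ h0u.trans (hφ b (subset_convexHull ℝ F hb))
  obtain ⟨ζ₀, rfl⟩ := (InnerProductSpace.toDual ℝ (EuclideanSpace ℝ (Fin d))).surjective φ
  simp only [InnerProductSpace.toDual_apply_apply] at hpos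
  have hMpos := hpos M (Set.mem_insert _ _)
  -- The scaling by `-b` gives the value `-C` at `M`, as `hmove` requires.
  set b := C / inner ℝ ζ₀ M with hb
  have hb0 : 0 < b := div_pos hC hMpos
  have hζM : inner ℝ ((-b) • ζ₀) M = -C := by
    rw [real_inner_smul_left, neg_mul, hb, div_mul_cancel₀ _ hMpos.ne']
  obtain ⟨k, hk, hkm⟩ := hmove _ hζM
  set ζ := (-b) • ζ₀ with hζ
  have hgain : f k * lrNorm q (e k).ofLp ≤ inner ℝ ζ (V k - M) := by
    rw [hV, hM, ← smul_sub, ← Finset.sum_sub_distrib, real_inner_smul_right, inner_sum, hf,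
      div_mul_eq_mul_div, div_eq_inv_mul, Finset.sum_mul]
    refine mul_le_mul_of_nonneg_left (Finset.sum_le_sum fun i _ ↦ ?_) (by positivity)
    by_cases h : w i ∈ U k ×ˢ {y k}
    · have h1 := hkm _ h.1
      have h2 : (w i).2 = y k := h.2
      simp only [hx', if_pos h, Set.indicator_of_mem h, one_mul, h2]
      exact h1
    · simp only [hx', if_neg h, Set.indicator_of_notMem h, zero_mul, sub_self, inner_zero_right,
        le_refl]
  have h1 : inner ℝ ζ (v k) = -C + a k * inner ℝ ζ (V k - M) := by
    rw [hv, ← hζM]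
    simp only [inner_add_right, real_inner_smul_right, inner_sub_right]
    ring
  have h2 : C ≤ a k * inner ℝ ζ (V k - M) := by
    rw [← haf k hk]
    exact mul_le_mul_of_nonneg_left hgain (ha0 k hk).le
  have h3 := hpos (v k) (Set.mem_insert_of_mem _ ⟨k, hk, rfl⟩)
  have h4 : inner ℝ ζ (v k) = -(b * inner ℝ ζ₀ (v k)) := by
    rw [hζ, real_inner_smul_left, neg_mul]
  -- The move raises `⟪ζ, ·⟫` from `-C` to at least `0`, but `ζ = -b ζ₀` with `⟪ζ₀, v k⟫ > 0`.
  nlinarith [mul_pos hb0 h3]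

end UpperBound

/-! ### Measurability of the profile function. -/

section Measurability

variable {d : ℕ} {p q : ℝ≥0∞} {β : EuclideanSpace ℝ (Fin d)}

lemma continuous_profile_empirical [Fact (1 ≤ q)] {n : ℕ} (hn : 1 ≤ n) (y : ℕ → ℝ) :
    Continuous fun x : ℕ → EuclideanSpace ℝ (Fin d) ↦
      (profile q β (empirical n fun i ↦ (x i, y i))).toReal := by
  set D : (ℕ → EuclideanSpace ℝ (Fin d)) → (ℕ → EuclideanSpace ℝ (Fin d)) → ℝ := fun x x' ↦
    (n : ℝ)⁻¹ * ∑ i ∈ Finset.range n, lrNorm q (x i - x' i).ofLp with hD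
  have hDcont (x : ℕ → EuclideanSpace ℝ (Fin d)) : Continuous (D x) := by
    refine continuous_const.mul (continuous_finsetSum _ fun i _ ↦ ?_)
    exact (continuous_lrNorm q).comp ((PiLp.continuous_ofLp 2 _).comp (by fun_prop))
  have hD0 (x x' : ℕ → EuclideanSpace ℝ (Fin d)) : 0 ≤ D x x' :=
    mul_nonneg (by positivity) (Finset.sum_nonneg fun i _ ↦ lrNorm_nonneg _ _)
  have hDsymm (x x' : ℕ → EuclideanSpace ℝ (Fin d)) : D x x' = D x' x := by
    simp only [hD]
    congr 1
    refine Finset.sum_congr rfl fun i _ ↦ ?_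
    rw [← neg_sub, WithLp.ofLp_neg, lrNorm_neg]
  have hle (x x' : ℕ → EuclideanSpace ℝ (Fin d)) :
      (profile q β (empirical n fun i ↦ (x' i, y i))).toReal ≤
        (profile q β (empirical n fun i ↦ (x i, y i))).toReal + D x x' := by
    rw [← ENNReal.toReal_ofReal (hD0 x x'),
      ← ENNReal.toReal_add (profile_empirical_ne_top hn _) ENNReal.ofReal_ne_top]
    refine ENNReal.toReal_mono ?_ (profile_empirical_le_add hn x x' y)
    exact ENNReal.add_ne_top.2 ⟨profile_empirical_ne_top hn _, ENNReal.ofReal_ne_top⟩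
  refine continuous_iff_continuousAt.2 fun x ↦ ?_
  refine tendsto_iff_dist_tendsto_zero.2 (squeeze_zero (fun _ ↦ dist_nonneg) (fun x' ↦ ?_)
    (g := D x) ?_)
  · rw [Real.dist_eq, abs_sub_le_iff]
    have h1 := hle x x'
    have h2 := hle x' x
    rw [hDsymm] at h2
    constructor <;> linarith
  · have := (hDcont x).tendsto x
    simpa [hD, lrNorm_zero] using this

/-- An uncountable infimum is not obviously measurable. Here it is continuous in the positions for
fixed labels, and the labels take finitely many values. -/
lemma aemeasurable_profile_empirical [Fact (1 ≤ q)] {Ω : Type*} [MeasurableSpace Ω] {P : Measure Ω}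
    {W : ℕ → Ω → EuclideanSpace ℝ (Fin d) × ℝ} (hW : ∀ i, AEMeasurable (W i) P)
    (hlabel : ∀ᵐ ω ∂P, ∀ i, (W i ω).2 = -1 ∨ (W i ω).2 = 1) {n : ℕ} (hn : 1 ≤ n) :
    AEMeasurable (fun ω ↦ (profile q β (empirical n fun i ↦ W i ω)).toReal) P := by
  classical
  -- The default `0` is harmless: indices `i ≥ n` do not enter `empirical n`.
  set y : (Fin n → Bool) → ℕ → ℝ := fun b i ↦
    if h : i < n then (if b ⟨i, h⟩ then 1 else -1) else 0 with hy
  set G : (ℕ → EuclideanSpace ℝ (Fin d)) × (Fin n → Bool) → ℝ := fun z ↦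
    (profile q β (empirical n fun i ↦ (z.1 i, y z.2 i))).toReal with hG
  have hGm : Measurable G := measurable_from_prod_countable_left fun b ↦
    (continuous_profile_empirical hn (y b)).measurable
  have hB : Measurable fun y : ℝ ↦ decide (y = 1) :=
    measurable_to_bool (by
      have : (fun y : ℝ ↦ decide (y = 1)) ⁻¹' {true} = {1} := by ext; simp
      rw [this]
      exact measurableSet_singleton 1)
  have hcomp : AEMeasurable (fun ω ↦ ((fun i ↦ (W i ω).1), fun j : Fin n ↦
      decide ((W j ω).2 = 1))) P := by
    refine AEMeasurable.prodMk (aemeasurable_pi_lambda _ fun i ↦ (hW i).fst)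
      (aemeasurable_pi_lambda _ fun j ↦ hB.comp_aemeasurable (hW j).snd)
  refine (hGm.comp_aemeasurable hcomp).congr ?_
  filter_upwards [hlabel] with ω hω
  simp only [Function.comp, hG]
  refine congrArg (fun Q ↦ (profile q β Q).toReal) ?_
  refine congrArg (fun Q ↦ (n : ℝ≥0∞)⁻¹ • Q) (Finset.sum_congr rfl fun i hi ↦ ?_)
  refine congrArg Measure.dirac (Prod.ext rfl ?_)
  simp only [hy, Finset.mem_range.1 hi, dif_pos]
  rcases hω i with h | h
  · simp only [h]; norm_num
  · simp [h]

end Measurability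

/-! ### Central limit theorem, tightness and law of large numbers. -/

section CentralLimit

variable {d : ℕ} {Ω Ω₁ : Type*} [MeasurableSpace Ω] [MeasurableSpace Ω₁] {P : Measure Ω}
  {P₁ : Measure Ω₁}

lemma charFun_map_inner {X : Ω → EuclideanSpace ℝ (Fin d)} (hX : AEMeasurable X P)
    (t : EuclideanSpace ℝ (Fin d)) (s : ℝ) :
    charFun (P.map fun ω ↦ (inner ℝ t (X ω) : ℝ)) s = charFun (P.map X) (s • t) := by
  have hm : AEMeasurable (fun ω ↦ (inner ℝ t (X ω) : ℝ)) P := hX.const_inner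
  rw [charFun_apply_real, charFun_apply, integral_map hX (by fun_prop),
    integral_map hm (by fun_prop)]
  simp [real_inner_smul_right, real_inner_comm]

variable [IsProbabilityMeasure P] [IsProbabilityMeasure P₁]

/-- The multivariate central limit theorem. -/
theorem tendstoInDistribution_inv_sqrt_smul_sum {X : ℕ → Ω → EuclideanSpace ℝ (Fin d)}
    {Z : Ω₁ → EuclideanSpace ℝ (Fin d)} {S : Matrix (Fin d) (Fin d) ℝ} (hS : S.PosSemidef)
    (hX : MemLp (X 0) 2 P) (h0 : P[X 0] = 0) (hindep : iIndepFun X P)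
    (hident : ∀ i, IdentDistrib (X i) (X 0) P P)
    (hcov : ∀ t : EuclideanSpace ℝ (Fin d),
      dotProduct t.ofLp (S.mulVec t.ofLp) = ∫ ω, (inner ℝ t (X 0 ω)) ^ 2 ∂P)
    (hZ : HasLaw Z (multivariateGaussian 0 S) P₁) :
    TendstoInDistribution (fun (n : ℕ) ω ↦ (√(n : ℝ))⁻¹ • ∑ i ∈ Finset.range n, X i ω) atTop Z
      (fun _ ↦ P) P₁ where
  forall_aemeasurable n :=
    (measurable_const_smul _).comp_aemeasurable
      (Finset.aemeasurable_fun_sum _ fun i _ ↦ (hident i).aemeasurable_fst)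
  aemeasurable_limit := hZ.aemeasurable
  tendsto := by
    refine ProbabilityMeasure.tendsto_iff_tendsto_charFun.2 fun t ↦ ?_
    simp only [ProbabilityMeasure.coe_mk]
    have hmeas (n : ℕ) : AEMeasurable
        (fun ω ↦ (√(n : ℝ))⁻¹ • ∑ i ∈ Finset.range n, X i ω) P :=
      (measurable_const_smul _).comp_aemeasurable
        (Finset.aemeasurable_fun_sum _ fun i _ ↦ (hident i).aemeasurable_fst)
    have hinner : Measurable fun x : EuclideanSpace ℝ (Fin d) ↦ (inner ℝ t x : ℝ) := by fun_prop
    have hL2 : MemLp (fun ω ↦ inner ℝ t (X 0 ω)) 2 P := hX.const_inner t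
    have hmean : ∫ ω, inner ℝ t (X 0 ω) ∂P = 0 := by
      rw [integral_inner (hX.integrable (by norm_num)), h0, inner_zero_right]
    have hvar : Var[fun ω ↦ inner ℝ t (X 0 ω); P] = dotProduct t.ofLp (S.mulVec t.ofLp) := by
      rw [variance_of_integral_eq_zero hL2.aemeasurable hmean, hcov]
    -- Cramér–Wold: the one-dimensional theorem for `⟪t, X i⟫`, read off at frequency `1`.
    have hclt := tendstoInDistribution_inv_sqrt_mul_sum_sub (P := P)
      (X := fun i ω ↦ inner ℝ t (X i ω)) HasLaw.id hL2
      (hindep.comp (fun _ x ↦ inner ℝ t x) fun _ ↦ hinner) fun i ↦ (hident i).comp hinner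
    have h1 := ProbabilityMeasure.tendsto_iff_tendsto_charFun.1 hclt.tendsto 1
    simp only [ProbabilityMeasure.coe_mk, Measure.map_id, charFun_gaussianReal, hmean, hvar,
      mul_zero, sub_zero] at h1
    rw [hZ.map_eq, charFun_multivariateGaussian hS]
    convert! h1 using 2 with n
    · rw [← one_smul ℝ t, ← charFun_map_inner (hmeas n), one_smul]
      simp only [real_inner_smul_right, inner_sum]
    · have : 0 ≤ dotProduct t.ofLp (S.mulVec t.ofLp) := by
        rw [hcov]
        exact integral_nonneg fun _ ↦ sq_nonneg _
      simp only [inner_zero_right, Complex.ofReal_zero, zero_mul, zero_sub, mul_zero,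
        Real.coe_toNNReal _ this]
      congr 1
      push_cast
      ring

/-- Characteristic functions converging to one continuous at `0` force tightness, with one bound for
all `n`. -/
lemma exists_forall_measure_norm_gt_le {X : ℕ → Ω → EuclideanSpace ℝ (Fin d)}
    {Z : Ω₁ → EuclideanSpace ℝ (Fin d)} (h : TendstoInDistribution X atTop Z (fun _ ↦ P) P₁)
    {ε : ℝ≥0∞} (hε : 0 < ε) :
    ∃ B : ℝ, 0 < B ∧ ∀ n, P {ω | B < ‖X n ω‖} ≤ ε := by
  have hm := h.forall_aemeasurable
  have hprob (n : ℕ) : IsProbabilityMeasure (P.map (X n)) := Measure.isProbabilityMeasure_map (hm n)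
  have : IsProbabilityMeasure (P₁.map Z) := Measure.isProbabilityMeasure_map h.aemeasurable_limit
  have h1 := ProbabilityMeasure.tendsto_iff_tendsto_charFun.1 h.tendsto
  have h2 := isTightMeasureSet_of_tendsto_charFun (μ := fun n ↦ P.map (X n))
    (f := charFun (P₁.map Z)) continuous_charFun.continuousAt h1
  rw [isTightMeasureSet_iff_tendsto_measure_norm_gt] at h2
  obtain ⟨B, hB, hB0⟩ := ((h2.eventually (gt_mem_nhds hε)).and (eventually_gt_atTop 0)).exists
  refine ⟨B, hB0, fun n ↦ le_trans ?_ hB.le⟩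
  refine le_trans ?_ (le_iSup₂ (f := fun (ν : Measure _) (_ : ν ∈ Set.range fun n ↦ P.map (X n)) ↦
    ν {x | B < ‖x‖}) (P.map (X n)) ⟨n, rfl⟩)
  rw [Measure.map_apply_of_aemeasurable (hm n) (measurableSet_lt measurable_const measurable_norm)]
  rfl

/-- The proportion of sample points in a set of positive probability is bounded below with
probability tending to one. -/
lemma tendsto_measure_fraction_lt {S : Type*} [MeasurableSpace S] {μ : Measure S}
    [IsProbabilityMeasure μ] {W : ℕ → Ω → S} (hindep : iIndepFun W P)
    (hlaw : ∀ i, HasLaw (W i) μ P) {D : Set S} (hD : MeasurableSet D) {η : ℝ}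
    (hη : η < μ.real D) :
    Tendsto (fun n : ℕ ↦ P {ω | (∑ i ∈ Finset.range n, D.indicator (fun _ ↦ (1 : ℝ)) (W i ω)) / n
      < η}) atTop (𝓝 0) := by
  have hg : Measurable (D.indicator fun _ ↦ (1 : ℝ)) := measurable_const.indicator hD
  have hint : Integrable (fun ω ↦ D.indicator (fun _ ↦ (1 : ℝ)) (W 0 ω)) P := by
    refine Integrable.of_bound (hg.comp_aemeasurable (hlaw 0).aemeasurable).aestronglyMeasurable 1
      (.of_forall fun ω ↦ ?_)
    by_cases h : W 0 ω ∈ D <;> simp [h]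
  have hslln := strong_law_ae_real (fun i ω ↦ D.indicator (fun _ ↦ (1 : ℝ)) (W i ω)) hint
    (fun i j hij ↦ (hindep.indepFun hij).comp hg hg)
    (fun i ↦ ((hlaw i).identDistrib (hlaw 0)).comp hg)
  have hmean : ∫ ω, D.indicator (fun _ ↦ (1 : ℝ)) (W 0 ω) ∂P = μ.real D := by
    have := (hlaw 0).integral_comp (f := D.indicator fun _ ↦ (1 : ℝ)) hg.aestronglyMeasurable
    rw [integral_indicator_const _ hD, smul_eq_mul, mul_one] at this
    exact this
  simp only [hmean] at hslln
  have hm (n : ℕ) : AEStronglyMeasurable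
      (fun ω ↦ (∑ i ∈ Finset.range n, D.indicator (fun _ ↦ (1 : ℝ)) (W i ω)) / n) P :=
    ((Finset.aemeasurable_fun_sum _ fun i _ ↦
      hg.comp_aemeasurable (hlaw i).aemeasurable).div_const _).aestronglyMeasurable
  have h := tendstoInMeasure_iff_dist.1 (tendstoInMeasure_of_tendsto_ae hm hslln)
    (μ.real D - η) (sub_pos.2 hη)
  refine tendsto_of_tendsto_of_tendsto_of_le_of_le tendsto_const_nhds h (fun _ ↦ zero_le)
    fun n ↦ measure_mono fun ω hω ↦ ?_
  simp only [Set.mem_ofPred_eq, Real.dist_eq] at hω ⊢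
  rw [abs_sub_comm]
  exact le_trans (by linarith) (le_abs_self _)

end CentralLimit

/-! ### Deterministic bounds on `√n R_n`. -/

section Sandwich

variable {d : ℕ} {p q : ℝ≥0∞} {β : EuclideanSpace ℝ (Fin d)}
  {μ : Measure (EuclideanSpace ℝ (Fin d) × ℝ)} [IsProbabilityMeasure μ]

/-- The normalized sum `-√n E_n[h]`. -/
noncomputable def normalizedScore (β : EuclideanSpace ℝ (Fin d)) (n : ℕ)
    (w : ℕ → EuclideanSpace ℝ (Fin d) × ℝ) : EuclideanSpace ℝ (Fin d) :=
  (√(n : ℝ))⁻¹ • ∑ i ∈ Finset.range n, -score β (w i).1 (w i).2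

lemma sqrt_mul_inner_mean (n : ℕ) (w : ℕ → EuclideanSpace ℝ (Fin d) × ℝ)
    (ζ : EuclideanSpace ℝ (Fin d)) :
    √(n : ℝ) * inner ℝ ζ ((n : ℝ)⁻¹ • ∑ i ∈ Finset.range n, score β (w i).1 (w i).2) =
      -inner ℝ ζ (normalizedScore β n w) := by
  rw [normalizedScore, Finset.sum_neg_distrib, smul_neg, inner_neg_right, neg_neg,
    real_inner_smul_right, real_inner_smul_right, ← mul_assoc]
  congr 1
  rcases eq_or_ne (√(n : ℝ)) 0 with h | h
  · simp [h]
  · rw [mul_inv_eq_iff_eq_mul₀, eq_inv_mul_iff_mul_eq₀ h, Real.mul_self_sqrt (by positivity)]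
    exact fun h0 ↦ h (by simp [h0])

/-- Lower half of the sandwich: weak duality at the empirical measure. -/
lemma IsLogisticModel.limitFun_le_sqrt_mul_profile (hμ : IsLogisticModel β μ)
    (hpq : p.HolderConjugate q) {n : ℕ} (hn : 1 ≤ n) {w : ℕ → EuclideanSpace ℝ (Fin d) × ℝ}
    (hw : ∀ i, (w i).2 = -1 ∨ (w i).2 = 1) :
    limitFun p β μ (normalizedScore β n w) ≤ √(n : ℝ) * (profile q β (empirical n w)).toReal := by
  have hp := fact_one_le_left hpq
  have hq := fact_one_le_right hpq
  refine hμ.limitFun_le hp fun ξ hξ ↦ ?_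
  have hlabel : ∀ᵐ v ∂(empirical n w), v.2 = -1 ∨ v.2 = 1 := by
    refine Measure.ae_smul_measure ?_ _
    rw [ae_finsetSum_measure_iff]
    intro i _
    rw [ae_dirac_eq]
    exact hw i
  have h := ofReal_neg_integral_inner_score_le_profile (q := q)
    (integrable_empirical hn w fun v ↦ score β v.1 v.2) hlabel
    ((hμ.mem_dualSet_iff_lipschitz hpq).1 hξ)
  rw [integral_empirical, ENNReal.ofReal_le_iff_le_toReal (profile_empirical_ne_top hn w)] at h
  rw [← neg_neg (inner ℝ ξ _), ← sqrt_mul_inner_mean, ← mul_neg]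
  gcongr

/-- The upper bound on the profile function, on the event that enough sample points are available
in each of finitely many regions. -/
lemma IsLogisticModel.exists_regions (hμ : IsLogisticModel β μ) (hpq : p.HolderConjugate q)
    {δ B : ℝ} (hδ : 0 < δ) (hB : 0 < B) :
    ∃ (t : Finset (EuclideanSpace ℝ (Fin d)))
      (D : EuclideanSpace ℝ (Fin d) → Set (EuclideanSpace ℝ (Fin d) × ℝ)) (η : ℝ) (N : ℕ),
      (∀ k ∈ t, MeasurableSet (D k) ∧ η < μ.real (D k)) ∧
      ∀ n ≥ N, 1 ≤ n → ∀ w : ℕ → EuclideanSpace ℝ (Fin d) × ℝ, ‖normalizedScore β n w‖ ≤ B →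
        (∀ k ∈ t, η ≤ (∑ i ∈ Finset.range n, (D k).indicator (fun _ ↦ (1 : ℝ)) (w i)) / n) →
        √(n : ℝ) * (profile q β (empirical n w)).toReal ≤
          limitFun p β μ (normalizedScore β n w) + δ := by
  have hp := fact_one_le_left hpq
  have hq := fact_one_le_right hpq
  obtain ⟨R, hR, hA⟩ := hμ.exists_norm_le_of_mem_dualSet hp
  obtain ⟨t, U, y, e, ht, hmove⟩ := hμ.exists_moves hpq (div_pos hδ hB)
  have hη : ∃ η : ℝ, 0 < η ∧ ∀ k ∈ t, η < μ.real (U k ×ˢ {y k}) := by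
    have h : ∀ᶠ η in 𝓝[>] (0 : ℝ), ∀ k ∈ t, η < μ.real (U k ×ˢ {y k}) := by
      rw [eventually_all_finset]
      intro k hk
      have h0 : 0 < μ.real (U k ×ˢ {y k}) :=
        ENNReal.toReal_pos (hμ.measure_prod_pos (ht k hk).1 (ht k hk).2.1 (ht k hk).2.2.1).ne'
          (measure_ne_top _ _)
      filter_upwards [Ioo_mem_nhdsGT h0] with η hη using hη.2
    obtain ⟨η, h1, h2⟩ := (h.and self_mem_nhdsWithin).exists
    exact ⟨η, h2, h1⟩
  obtain ⟨η, hη, hηt⟩ := hη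
  -- `R * B` bounds `limitFun` on the ball of radius `B`, so the budget `C` below is at most the
  -- left side.
  have hN : ∀ᶠ n : ℕ in atTop, ∀ k ∈ t,
      (√(n : ℝ))⁻¹ * (R * B + δ) ≤ η * lrNorm q (e k).ofLp := by
    rw [eventually_all_finset]
    intro k hk
    have h1 : Tendsto (fun n : ℕ ↦ (√(n : ℝ))⁻¹ * (R * B + δ)) atTop (𝓝 (0 * (R * B + δ))) :=
      (tendsto_inv_atTop_zero.comp
        (Real.tendsto_sqrt_atTop.comp tendsto_natCast_atTop_atTop)).mul_const _
    rw [zero_mul] at h1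
    exact h1.eventually_le_const (mul_pos hη (ht k hk).2.2.2)
  obtain ⟨N, hN⟩ := eventually_atTop.1 hN
  refine ⟨t, fun k ↦ U k ×ˢ {y k}, η, N, fun k hk ↦
    ⟨(ht k hk).1.measurableSet.prod (measurableSet_singleton _), hηt k hk⟩, ?_⟩
  intro n hnN hn w hwB hfrac
  have hs : 0 < √(n : ℝ) := Real.sqrt_pos.2 (by exact_mod_cast hn)
  set z := normalizedScore β n w with hz
  have hL0 := hμ.limitFun_nonneg hp z
  have hLB : limitFun p β μ z ≤ R * B := hμ.limitFun_le hp fun ξ hξ ↦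
    (real_inner_le_norm ξ z).trans (by gcongr; exact hA ξ hξ)
  set C := (√(n : ℝ))⁻¹ * (limitFun p β μ z + δ) with hC
  have hC0 : 0 < C := by positivity
  have hle : profile q β (empirical n w) ≤ ENNReal.ofReal C := by
    refine profile_empirical_le_of_moves (fun k hk ↦ (ht k hk).2.2.2) hn hη hC0 hfrac
      (fun k hk ↦ le_trans ?_ (hN n hnN k hk)) fun ζ hζ ↦ hmove ζ fun ξ hξ ↦ ?_
    · rw [hC]
      gcongr
    · have h1 : inner ℝ ζ z = limitFun p β μ z + δ := by
        have h2 := sqrt_mul_inner_mean (β := β) n w ζ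
        rw [hζ, mul_neg, neg_inj, hC, mul_inv_cancel_left₀ hs.ne'] at h2
        exact h2.symm
      have h2 := hμ.inner_le_limitFun hp hξ z
      -- `⟪ζ, z⟫` exceeds every `⟪ξ, z⟫` by `δ`, so `ζ` is at distance at least `δ / B` from
      -- `dualSet`.
      have h3 : δ ≤ ‖ζ - ξ‖ * B := by
        calc δ ≤ inner ℝ (ζ - ξ) z := by rw [inner_sub_left]; linarith
          _ ≤ ‖ζ - ξ‖ * ‖z‖ := real_inner_le_norm _ _
          _ ≤ ‖ζ - ξ‖ * B := by gcongr
      rwa [div_le_iff₀ hB]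
  calc √(n : ℝ) * (profile q β (empirical n w)).toReal ≤ √(n : ℝ) * C := by
        gcongr
        exact ENNReal.toReal_le_of_le_ofReal hC0.le hle
    _ = limitFun p β μ z + δ := by rw [hC, mul_inv_cancel_left₀ hs.ne']

end Sandwich

/-! ### Convergence in distribution. -/

section Convergence

variable {d : ℕ} {p q : ℝ≥0∞} {β : EuclideanSpace ℝ (Fin d)}
  {μ : Measure (EuclideanSpace ℝ (Fin d) × ℝ)} [IsProbabilityMeasure μ]
  {Ω Ω₁ : Type*} [MeasurableSpace Ω] [MeasurableSpace Ω₁] {P : Measure Ω}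
  {P₁ : Measure Ω₁} {W : ℕ → Ω → EuclideanSpace ℝ (Fin d) × ℝ} {Z : Ω₁ → EuclideanSpace ℝ (Fin d)}

lemma IsLogisticModel.ae_label_sample (hμ : IsLogisticModel β μ)
    (hlaw : ∀ i, HasLaw (W i) μ P) : ∀ᵐ ω ∂P, ∀ i, (W i ω).2 = -1 ∨ (W i ω).2 = 1 := by
  refine ae_all_iff.2 fun i ↦ ?_
  have h := hμ.label
  rw [← (hlaw i).map_eq] at h
  exact ae_of_ae_map (hlaw i).aemeasurable h

lemma IsLogisticModel.aemeasurable_sqrt_mul_profile (hμ : IsLogisticModel β μ) [Fact (1 ≤ q)]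
    (hlaw : ∀ i, HasLaw (W i) μ P) (n : ℕ) :
    AEMeasurable (fun ω ↦ √(n : ℝ) * (profile q β (empirical n fun i ↦ W i ω)).toReal) P := by
  rcases Nat.eq_zero_or_pos n with rfl | hn
  · simp
  · exact (aemeasurable_profile_empirical (fun i ↦ (hlaw i).aemeasurable)
      (hμ.ae_label_sample hlaw) hn).const_mul _

variable [IsProbabilityMeasure P] [IsProbabilityMeasure P₁]

lemma IsLogisticModel.tendstoInDistribution_normalizedScore (hμ : IsLogisticModel β μ)
    (hmom : Integrable (fun w ↦ ‖w.1‖ ^ 2) μ)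
    (hindep : iIndepFun W P) (hlaw : ∀ i, HasLaw (W i) μ P)
    (hZ : HasLaw Z (multivariateGaussian 0 (scoreCov β μ)) P₁) :
    TendstoInDistribution (fun (n : ℕ) ω ↦ normalizedScore β n fun i ↦ W i ω) atTop Z
      (fun _ ↦ P) P₁ := by
  have hc : Continuous fun w : EuclideanSpace ℝ (Fin d) × ℝ ↦ -score β w.1 w.2 :=
    (continuous_score β).neg
  refine tendstoInDistribution_inv_sqrt_smul_sum
    (X := fun i ω ↦ -score β (W i ω).1 (W i ω).2) (posSemidef_scoreCov hmom) ?_ ?_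
    (hindep.comp (fun _ w ↦ -score β w.1 w.2) fun _ ↦ hc.measurable)
    (fun i ↦ ((hlaw i).identDistrib (hlaw 0)).comp hc.measurable) (fun t ↦ ?_) hZ
  · have h := (hμ.memLp_score hmom).neg
    rw [← (hlaw 0).map_eq] at h
    exact (memLp_map_measure_iff hc.aestronglyMeasurable (hlaw 0).aemeasurable).1 h
  · have := (hlaw 0).integral_comp (f := fun w ↦ -score β w.1 w.2) hc.aestronglyMeasurable
    rw [integral_neg, hμ.integral_score hmom, neg_zero] at this
    exact this
  · rw [hμ.dotProduct_scoreCov_mulVec hmom]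
    have hc' : Continuous fun w : EuclideanSpace ℝ (Fin d) × ℝ ↦
      (inner ℝ t (score β w.1 w.2)) ^ 2 := (continuous_const.inner (continuous_score β)).pow 2
    have := (hlaw 0).integral_comp (f := fun w ↦ (inner ℝ t (score β w.1 w.2)) ^ 2)
      hc'.aestronglyMeasurable
    rw [← this]
    simp [inner_neg_right]

/-- The upper bound holds off two events: a large normalized score, controlled by tightness, and a
poorly filled region, controlled by the law of large numbers. -/
lemma IsLogisticModel.tendstoInMeasure_sub (hμ : IsLogisticModel β μ)
    (hpq : p.HolderConjugate q)
    (hmom : Integrable (fun w ↦ ‖w.1‖ ^ 2) μ)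
    (hindep : iIndepFun W P) (hlaw : ∀ i, HasLaw (W i) μ P)
    (hZ : HasLaw Z (multivariateGaussian 0 (scoreCov β μ)) P₁) :
    TendstoInMeasure P ((fun (n : ℕ) ω ↦
      √(n : ℝ) * (profile q β (empirical n fun i ↦ W i ω)).toReal) -
        fun (n : ℕ) ω ↦ limitFun p β μ (normalizedScore β n fun i ↦ W i ω)) atTop 0 := by
  rw [tendstoInMeasure_iff_norm]
  intro ε hε
  rw [ENNReal.tendsto_nhds_zero]
  intro τ hτ
  obtain ⟨B, hB, hBn⟩ := exists_forall_measure_norm_gt_le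
    (hμ.tendstoInDistribution_normalizedScore hmom hindep hlaw hZ) (ENNReal.half_pos hτ.ne')
  obtain ⟨t, D, η, N, hD, hmain⟩ := hμ.exists_regions hpq (half_pos hε) hB
  have hfrac : Tendsto (fun n : ℕ ↦ ∑ k ∈ t, P {ω |
      (∑ i ∈ Finset.range n, (D k).indicator (fun _ ↦ (1 : ℝ)) (W i ω)) / n < η}) atTop (𝓝 0) := by
    simpa using tendsto_finsetSum t fun k hk ↦
      tendsto_measure_fraction_lt hindep hlaw (hD k hk).1 (hD k hk).2
  filter_upwards [ENNReal.tendsto_nhds_zero.1 hfrac _ (ENNReal.half_pos hτ.ne'),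
    eventually_ge_atTop N, eventually_ge_atTop 1] with n hfn hnN hn
  have hsub : ∀ᵐ ω ∂P, ω ∈ {ω | ε ≤ ‖(((fun (n : ℕ) ω ↦
      √(n : ℝ) * (profile q β (empirical n fun i ↦ W i ω)).toReal) -
        fun (n : ℕ) ω ↦ limitFun p β μ (normalizedScore β n fun i ↦ W i ω)) : ℕ → Ω → ℝ) n ω -
          (0 : Ω → ℝ) ω‖} →
      ω ∈ {ω | B < ‖normalizedScore β n fun i ↦ W i ω‖} ∪ ⋃ k ∈ t, {ω |
        (∑ i ∈ Finset.range n, (D k).indicator (fun _ ↦ (1 : ℝ)) (W i ω)) / n < η} := by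
    filter_upwards [hμ.ae_label_sample hlaw] with ω hω hbig
    by_contra hnot
    simp only [Set.mem_union, Set.mem_iUnion, Set.mem_ofPred_eq, not_or, not_exists, not_lt]
      at hnot
    have h1 := hmain n hnN hn (fun i ↦ W i ω) hnot.1 fun k hk ↦ hnot.2 k hk
    have h2 := hμ.limitFun_le_sqrt_mul_profile hpq hn hω
    simp only [Pi.sub_apply, Pi.zero_apply, sub_zero, Real.norm_eq_abs] at hbig
    -- The lower bound makes the difference nonnegative; the upper bound keeps it at most `ε / 2`.
    rw [abs_of_nonneg (sub_nonneg.2 h2)] at hbig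
    linarith
  calc _ ≤ P ({ω | B < ‖normalizedScore β n fun i ↦ W i ω‖} ∪ ⋃ k ∈ t, {ω |
        (∑ i ∈ Finset.range n, (D k).indicator (fun _ ↦ (1 : ℝ)) (W i ω)) / n < η}) :=
        measure_mono_ae hsub
    _ ≤ τ / 2 + τ / 2 := (measure_union_le _ _).trans
        (add_le_add (hBn n) ((measure_biUnion_finset_le _ _).trans hfn))
    _ = τ := ENNReal.add_halves τ

theorem IsLogisticModel.tendstoInDistribution_profile (hμ : IsLogisticModel β μ)
    (hpq : p.HolderConjugate q)
    (hmom : Integrable (fun w ↦ ‖w.1‖ ^ 2) μ)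
    (hindep : iIndepFun W P) (hlaw : ∀ i, HasLaw (W i) μ P)
    (hZ : HasLaw Z (multivariateGaussian 0 (scoreCov β μ)) P₁) :
    TendstoInDistribution
      (fun (n : ℕ) ω ↦ √(n : ℝ) * (profile q β (empirical n fun i ↦ W i ω)).toReal)
      atTop (fun ω ↦ limitFun p β μ (Z ω)) (fun _ ↦ P) P₁ := by
  have hp := fact_one_le_left hpq
  have hq := fact_one_le_right hpq
  obtain ⟨K, hK⟩ := hμ.exists_lipschitzWith_limitFun hp
  exact tendstoInDistribution_of_tendstoInMeasure_sub _ _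
    ((hμ.tendstoInDistribution_normalizedScore hmom hindep hlaw hZ).continuous_comp
      (g := limitFun p β μ) hK.continuous)
    (hμ.tendstoInMeasure_sub hpq hmom hindep hlaw hZ) (hμ.aemeasurable_sqrt_mul_profile hlaw)

end Convergence

/-! ### Projections and comparison of centred Gaussians. -/

section GaussianComparison

/-- The narrower Gaussian is the image of the wider one under multiplication by `√(v₁ / v₂) ≤ 1`. -/
lemma gaussianReal_measure_lt_abs_mono {v₁ v₂ : NNReal} (h : v₁ ≤ v₂) (t : ℝ) :
    gaussianReal 0 v₁ {x | t < |x|} ≤ gaussianReal 0 v₂ {x | t < |x|} := by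
  rcases eq_or_ne v₂ 0 with rfl | hv
  · rw [le_antisymm h zero_le]
  have hmeas : MeasurableSet {x : ℝ | t < |x|} :=
    measurableSet_lt measurable_const (continuous_abs.measurable)
  set c : ℝ := √((v₁ : ℝ) / v₂) with hc
  have hc2 : c ^ 2 = (v₁ : ℝ) / v₂ := Real.sq_sqrt (by positivity)
  have hc1 : c ≤ 1 := Real.sqrt_le_one.2 (div_le_one_of_le₀ (by exact_mod_cast h) v₂.2)
  have hmap : gaussianReal 0 v₁ = (gaussianReal 0 v₂).map (fun x ↦ c * x) := by
    rw [gaussianReal_map_const_mul, mul_zero]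
    congr 1
    ext
    push_cast
    rw [hc2, div_mul_cancel₀ _ (by exact_mod_cast hv)]
  rw [hmap, Measure.map_apply (by fun_prop) hmeas]
  refine measure_mono fun x hx ↦ ?_
  simp only [Set.mem_preimage, Set.mem_ofPred_eq, abs_mul, abs_of_nonneg (Real.sqrt_nonneg _),
    hc] at hx ⊢
  exact hx.trans_le (mul_le_of_le_one_left (abs_nonneg x) hc1)

variable {d : ℕ} {Ω : Type*} [MeasurableSpace Ω] {P : Measure Ω}
  {Z : Ω → EuclideanSpace ℝ (Fin d)} {S : Matrix (Fin d) (Fin d) ℝ}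

lemma charFun_map_of_hasLaw_multivariateGaussian (hS : S.PosSemidef)
    (hZ : HasLaw Z (multivariateGaussian 0 S) P) (t : EuclideanSpace ℝ (Fin d)) :
    charFun (P.map Z) t = Complex.exp (-dotProduct t.ofLp (S.mulVec t.ofLp) / 2) := by
  rw [hZ.map_eq, charFun_multivariateGaussian hS]
  simp [neg_div]

variable [IsProbabilityMeasure P]

lemma hasLaw_inner_of_multivariateGaussian (hS : S.PosSemidef)
    (hZ : HasLaw Z (multivariateGaussian 0 S) P) (b : EuclideanSpace ℝ (Fin d)) :
    HasLaw (fun ω ↦ (inner ℝ b (Z ω) : ℝ))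
      (gaussianReal 0 (dotProduct b.ofLp (S.mulVec b.ofLp)).toNNReal) P := by
  have hm : AEMeasurable (fun ω ↦ (inner ℝ b (Z ω) : ℝ)) P := hZ.aemeasurable.const_inner
  refine ⟨hm, ?_⟩
  have : IsProbabilityMeasure (P.map fun ω ↦ (inner ℝ b (Z ω) : ℝ)) :=
    Measure.isProbabilityMeasure_map hm
  have hnonneg : 0 ≤ dotProduct b.ofLp (S.mulVec b.ofLp) := by
    simpa using hS.dotProduct_mulVec_nonneg b.ofLp
  refine Measure.ext_of_charFun (funext fun s ↦ ?_)
  rw [charFun_map_inner hZ.aemeasurable, charFun_map_of_hasLaw_multivariateGaussian hS hZ,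
    charFun_gaussianReal,
    Real.coe_toNNReal _ hnonneg]
  congr 1
  simp only [WithLp.ofLp_smul, Matrix.mulVec_smul, smul_dotProduct, dotProduct_smul, smul_eq_mul]
  push_cast
  ring

lemma hasLaw_smul_of_multivariateGaussian {S' : Matrix (Fin d) (Fin d) ℝ} {c : ℝ}
    (hS : S.PosSemidef) (hS' : S'.PosSemidef)
    (hZ : HasLaw Z (multivariateGaussian 0 S) P) (h : S' = c ^ 2 • S) :
    HasLaw (fun ω ↦ c • Z ω) (multivariateGaussian 0 S') P := by
  have hm : AEMeasurable (fun ω ↦ c • Z ω) P :=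
    (measurable_const_smul c).comp_aemeasurable hZ.aemeasurable
  refine ⟨hm, ?_⟩
  have : IsProbabilityMeasure (P.map fun ω ↦ c • Z ω) := Measure.isProbabilityMeasure_map hm
  refine Measure.ext_of_charFun (funext fun t ↦ ?_)
  rw [charFun_map_smul_comp hZ.aemeasurable, charFun_map_of_hasLaw_multivariateGaussian hS hZ,
    charFun_multivariateGaussian hS', h]
  congr 1
  simp only [WithLp.ofLp_smul, Matrix.mulVec_smul, smul_dotProduct, dotProduct_smul, smul_eq_mul,
    Matrix.smul_mulVec, inner_zero_right]
  push_cast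
  ring

end GaussianComparison

/-! ### Stochastic domination of the limit. -/

section Domination

variable {d : ℕ} {p q : ℝ≥0∞} {β : EuclideanSpace ℝ (Fin d)}
  {μ : Measure (EuclideanSpace ℝ (Fin d) × ℝ)} [IsProbabilityMeasure μ]

lemma IsLogisticModel.limitFun_le_two_mul_lrNorm (hμ : IsLogisticModel β μ)
    (hpq : p.HolderConjugate q) (z : EuclideanSpace ℝ (Fin d)) :
    limitFun p β μ z ≤ 2 * lrNorm q z.ofLp := by
  have hp := fact_one_le_left hpq
  have hq := fact_one_le_right hpq
  refine hμ.limitFun_le hp fun ξ hξ ↦ (inner_le_lrNorm_mul hpq ξ z).trans ?_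
  have := lrNorm_nonneg q z.ofLp
  gcongr
  exact hμ.lrNorm_le_two hp hξ

/-- At `x = s • v` with `v ⊥ β` the gradient for `y = 1` is `-ξ/2 + (s ⟪ξ, v⟫ / 4) β`, unbounded in
`s` unless `⟪ξ, v⟫ = 0`. -/
lemma IsLogisticModel.inner_eq_zero_of_mem_dualSet (hμ : IsLogisticModel β μ) (hp : Fact (1 ≤ p))
    (hβ : β ≠ 0) {ξ v : EuclideanSpace ℝ (Fin d)} (hξ : ξ ∈ dualSet p β μ)
    (hv : inner ℝ β v = 0) : inner ℝ ξ v = 0 := by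
  by_contra hne
  obtain ⟨j, hj⟩ : ∃ j, β j ≠ 0 := by
    by_contra! h
    exact hβ (by ext j; simpa using h j)
  -- Solves for the `j`-th gradient coordinate to be `2`, which exceeds the allowed `1`.
  set s : ℝ := 4 / (inner ℝ ξ v * β j) * (ξ j / 2 + 2) with hs
  have h := (abs_apply_le_lrNorm p _ j).trans
    ((hμ.mem_dualSet_iff hp).1 hξ 1 (.inr rfl) (s • v))
  have h2 : (scoreGrad β ξ (s • v) 1) j = 2 := by
    simp only [scoreGrad, real_inner_smul_right, hv, mul_zero, Real.exp_zero, PiLp.add_apply,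
      PiLp.smul_apply, smul_eq_mul]
    rw [hs]
    field_simp
    ring
  rw [h2] at h
  norm_num at h

/-- For `β ≠ 0` the dual set is contained in a segment in the direction of `β`. -/
lemma IsLogisticModel.exists_smul_of_mem_dualSet (hμ : IsLogisticModel β μ) (hp : Fact (1 ≤ p))
    (hβ : β ≠ 0) {ξ : EuclideanSpace ℝ (Fin d)} (hξ : ξ ∈ dualSet p β μ) :
    ∃ c : ℝ, ξ = c • β ∧ |c| * lrNorm p β.ofLp ≤ 1 := by
  have hβ2 : inner ℝ β β ≠ 0 := by simpa using hβ
  set c := inner ℝ β ξ / inner ℝ β β with hc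
  have hperp : inner ℝ β (ξ - c • β) = 0 := by
    rw [inner_sub_right, real_inner_smul_right, hc, div_mul_cancel₀ _ hβ2, sub_self]
  have h1 := hμ.inner_eq_zero_of_mem_dualSet hp hβ hξ hperp
  have h2 : ξ = c • β := by
    rw [← sub_eq_zero, ← inner_self_eq_zero (𝕜 := ℝ), inner_sub_left, h1, real_inner_smul_left,
      hperp, mul_zero, sub_zero]
  refine ⟨c, h2, ?_⟩
  -- At this point `⟪β, x⟫ = -2`, and the gradient is `-c β` times a factor at least `1`; no limit
  -- `⟪β, x⟫ → -∞` is needed.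
  have h3 := (hμ.mem_dualSet_iff hp).1 hξ 1 (.inr rfl) ((-2 / inner ℝ β β) • β)
  have hE : Real.exp (-2) ≤ 1 := Real.exp_le_one_iff.2 (by norm_num)
  have hE0 := Real.exp_pos (-2)
  have h4 : scoreGrad β ξ ((-2 / inner ℝ β β) • β) 1 =
      (-c * (1 / (1 + Real.exp (-2)) + 2 * Real.exp (-2) / (1 + Real.exp (-2)) ^ 2)) • β := by
    rw [scoreGrad, real_inner_smul_right, real_inner_smul_right, div_mul_cancel₀ _ hβ2, one_mul, h2,
      real_inner_smul_left, smul_smul, ← add_smul,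
      show -2 / inner ℝ β β * (c * inner ℝ β β) = -2 * c by field_simp]
    congr 1
    ring
  rw [h4, WithLp.ofLp_smul, lrNorm_smul, abs_mul, abs_neg] at h3
  refine le_trans ?_ h3
  have := lrNorm_nonneg p β.ofLp
  gcongr
  refine le_mul_of_one_le_right (abs_nonneg c) (le_trans ?_ (le_abs_self _))
  rw [div_add_div _ _ (by positivity) (by positivity), le_div_iff₀ (by positivity)]
  -- With `E = exp (-2)` the claim reduces to `E² ≤ E`.
  nlinarith [mul_pos hE0 hE0]

lemma IsLogisticModel.limitFun_mul_lrNorm_le (hμ : IsLogisticModel β μ) (hp : Fact (1 ≤ p))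
    (hβ : β ≠ 0) (z : EuclideanSpace ℝ (Fin d)) :
    limitFun p β μ z * lrNorm p β.ofLp ≤ |inner ℝ β z| := by
  have hpos : 0 < lrNorm p β.ofLp := lrNorm_pos fun h ↦ hβ (by ext i; simp [h])
  rw [← le_div_iff₀ hpos]
  refine hμ.limitFun_le hp fun ξ hξ ↦ ?_
  obtain ⟨c, rfl, hc⟩ := hμ.exists_smul_of_mem_dualSet hp hβ hξ
  rw [le_div_iff₀ hpos, real_inner_smul_left]
  calc c * inner ℝ β z * lrNorm p β.ofLp ≤ |c| * |inner ℝ β z| * lrNorm p β.ofLp := by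
        refine mul_le_mul_of_nonneg_right ?_ hpos.le
        rw [← abs_mul]
        exact le_abs_self _
    _ = |c| * lrNorm p β.ofLp * |inner ℝ β z| := by ring
    _ ≤ 1 * |inner ℝ β z| := by gcongr
    _ = _ := one_mul _

lemma secondMoment_eq_smul_scoreCov_zero (μ : Measure (EuclideanSpace ℝ (Fin d) × ℝ)) :
    secondMoment μ = (2 : ℝ) ^ 2 • scoreCov 0 μ := by
  ext i j
  simp only [secondMoment, scoreCov, Matrix.of_apply, Matrix.smul_apply, smul_eq_mul,
    inner_zero_left, mul_zero, Real.exp_zero]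
  rw [← integral_const_mul]
  congr 1 with w
  ring

/-- The logistic weights are at most `1`. -/
lemma IsLogisticModel.dotProduct_scoreCov_le (hμ : IsLogisticModel β μ)
    (hmom : Integrable (fun w ↦ ‖w.1‖ ^ 2) μ) (t : EuclideanSpace ℝ (Fin d)) :
    dotProduct t.ofLp ((scoreCov β μ).mulVec t.ofLp) ≤
      dotProduct t.ofLp ((secondMoment μ).mulVec t.ofLp) := by
  rw [hμ.dotProduct_scoreCov_mulVec hmom, dotProduct_secondMoment_mulVec hmom]
  refine integral_mono_of_nonneg (.of_forall fun w ↦ sq_nonneg _)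
    ((memLp_fst hmom).const_inner t).integrable_sq ?_
  filter_upwards [hμ.ae_abs_label] with w hw
  rw [score, real_inner_smul_right, mul_pow]
  refine mul_le_of_le_one_left (sq_nonneg _) ?_
  rw [sq_le_one_iff_abs_le_one, abs_div, abs_neg, hw, abs_of_pos (by positivity)]
  exact div_le_one_of_le₀ (by linarith [Real.exp_pos (w.2 * inner ℝ β w.1)]) (by positivity)

theorem IsLogisticModel.measure_lt_limitFun_le (hμ : IsLogisticModel β μ)
    (hpq : p.HolderConjugate q) (hmom : Integrable (fun w ↦ ‖w.1‖ ^ 2) μ)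
    {Ω₁ Ω₂ : Type*} [MeasurableSpace Ω₁] [MeasurableSpace Ω₂]
    {P₁ : Measure Ω₁} [IsProbabilityMeasure P₁] {P₂ : Measure Ω₂} [IsProbabilityMeasure P₂]
    {Z : Ω₁ → EuclideanSpace ℝ (Fin d)} {Z' : Ω₂ → EuclideanSpace ℝ (Fin d)}
    (hZ : HasLaw Z (multivariateGaussian 0 (scoreCov β μ)) P₁)
    (hZ' : HasLaw Z' (multivariateGaussian 0 (secondMoment μ)) P₂) (t : ℝ) :
    P₁ {ω | t < limitFun p β μ (Z ω)} ≤ P₂ {ω | t < lrNorm q (Z' ω).ofLp} := by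
  have hp := fact_one_le_left hpq
  have hq := fact_one_le_right hpq
  rcases eq_or_ne β 0 with rfl | hβ
  · have hmeas : MeasurableSet {z : EuclideanSpace ℝ (Fin d) | t < lrNorm q z.ofLp} :=
      (isOpen_lt continuous_const
        ((continuous_lrNorm q).comp (PiLp.continuous_ofLp 2 _))).measurableSet
    have h2Z := hasLaw_smul_of_multivariateGaussian (posSemidef_scoreCov hmom)
      (posSemidef_secondMoment hmom) hZ (secondMoment_eq_smul_scoreCov_zero μ)
    rw [hZ'.measure_eq (p := fun z ↦ t < lrNorm q z.ofLp) hmeas,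
      ← h2Z.measure_eq (p := fun z ↦ t < lrNorm q z.ofLp) hmeas]
    refine measure_mono fun ω hω ↦ ?_
    simp only [Set.mem_ofPred_eq, WithLp.ofLp_smul, lrNorm_smul] at hω ⊢
    rw [abs_of_pos (by norm_num)]
    exact hω.trans_le (hμ.limitFun_le_two_mul_lrNorm hpq _)
  · have hpos : 0 < lrNorm p β.ofLp := lrNorm_pos fun h ↦ hβ (by ext i; simp [h])
    have hmeas : MeasurableSet {x : ℝ | t * lrNorm p β.ofLp < |x|} :=
      (isOpen_lt continuous_const continuous_abs).measurableSet
    calc P₁ {ω | t < limitFun p β μ (Z ω)}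
        ≤ P₁ {ω | t * lrNorm p β.ofLp < |inner ℝ β (Z ω)|} := by
          refine measure_mono fun ω hω ↦ ?_
          exact (mul_lt_mul_of_pos_right hω hpos).trans_le (hμ.limitFun_mul_lrNorm_le hp hβ _)
      _ = gaussianReal 0 _ {x | t * lrNorm p β.ofLp < |x|} :=
          (hasLaw_inner_of_multivariateGaussian (posSemidef_scoreCov hmom) hZ β).measure_eq
            (p := fun x ↦ t * lrNorm p β.ofLp < |x|) hmeas
      _ ≤ gaussianReal 0 _ {x | t * lrNorm p β.ofLp < |x|} :=
          gaussianReal_measure_lt_abs_mono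
            (Real.toNNReal_le_toNNReal (hμ.dotProduct_scoreCov_le hmom β)) _
      _ = P₂ {ω | t * lrNorm p β.ofLp < |inner ℝ β (Z' ω)|} :=
          ((hasLaw_inner_of_multivariateGaussian (posSemidef_secondMoment hmom) hZ' β).measure_eq
            (p := fun x ↦ t * lrNorm p β.ofLp < |x|) hmeas).symm
      _ ≤ P₂ {ω | t < lrNorm q (Z' ω).ofLp} := by
          refine measure_mono fun ω hω ↦ ?_
          refine lt_of_mul_lt_mul_right (hω.trans_le ?_) hpos.le
          refine abs_le'.2 ⟨?_, ?_⟩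
          · rw [mul_comm]
            exact inner_le_lrNorm_mul hpq β (Z' ω)
          · have := inner_le_lrNorm_mul hpq β (-Z' ω)
            rwa [inner_neg_right, WithLp.ofLp_neg, lrNorm_neg, mul_comm] at this

end Domination

end LogisticRWP

theorem mainTheorem7 {d : ℕ} {p q : ℝ≥0∞} (hpq : p.HolderConjugate q)
    (β : EuclideanSpace ℝ (Fin d))
    (μ : Measure (EuclideanSpace ℝ (Fin d) × ℝ)) [IsProbabilityMeasure μ]
    (hμ : LogisticRWP.IsLogisticModel β μ)
    (hmom : Integrable (fun w ↦ ‖w.1‖ ^ 2) μ)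
    {Ω : Type*} [MeasurableSpace Ω] (P : Measure Ω) [IsProbabilityMeasure P]
    (W : ℕ → Ω → EuclideanSpace ℝ (Fin d) × ℝ)
    (hindep : iIndepFun W P) (hlaw : ∀ i, HasLaw (W i) μ P)
    {Ω₁ : Type*} [MeasurableSpace Ω₁] (P₁ : Measure Ω₁) [IsProbabilityMeasure P₁]
    (Z : Ω₁ → EuclideanSpace ℝ (Fin d))
    (hZ : HasLaw Z (multivariateGaussian 0 (LogisticRWP.scoreCov β μ)) P₁)
    {Ω₂ : Type*} [MeasurableSpace Ω₂] (P₂ : Measure Ω₂) [IsProbabilityMeasure P₂]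
    (Z' : Ω₂ → EuclideanSpace ℝ (Fin d))
    (hZ' : HasLaw Z' (multivariateGaussian 0 (LogisticRWP.secondMoment μ)) P₂) :
    -- the profile function is finite and the supremum defining the limit is finite
    (∀ n : ℕ, 1 ≤ n → ∀ ω,
      LogisticRWP.profile q β (LogisticRWP.empirical n fun i ↦ W i ω) ≠ ∞) ∧
    (∀ z : EuclideanSpace ℝ (Fin d),
      BddAbove ((fun ξ ↦ inner ℝ ξ z) '' LogisticRWP.dualSet p β μ)) ∧
    -- convergence in distribution
    TendstoInDistribution
      (fun (n : ℕ) ω ↦ √(n : ℝ) *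
        (LogisticRWP.profile q β (LogisticRWP.empirical n fun i ↦ W i ω)).toReal)
      atTop (fun ω ↦ LogisticRWP.limitFun p β μ (Z ω)) (fun _ ↦ P) P₁ ∧
    -- stochastic domination
    (∀ t : ℝ, P₁ {ω | t < LogisticRWP.limitFun p β μ (Z ω)} ≤
      P₂ {ω | t < LogisticRWP.lrNorm q (Z' ω).ofLp}) := by
  have hp : Fact (1 ≤ p) := LogisticRWP.fact_one_le_left hpq
  have hq : Fact (1 ≤ q) := LogisticRWP.fact_one_le_right hpq
  exact ⟨fun n hn ω ↦ LogisticRWP.profile_empirical_ne_top hn _, hμ.bddAbove_inner_dualSet hp,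
    hμ.tendstoInDistribution_profile hpq hmom hindep hlaw hZ,
    hμ.measure_lt_limitFun_le hpq hmom hZ hZ'⟩
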